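/- **Setting.** Let $\Sigma$ be a propositional signature (a set of atoms). A *literal* is $a$, $not\,a$ or $not\,not\,a$ with $a\in\Sigma$. A *rule* $r$ is a pair $H(r)\leftarrow B(r)$ with $H(r)\subseteq\Sigma$ a finite set of atoms (the head) and $B(r)$ a finite set of literals (the body); a *program* is a finite set of rules. Put $B^+(r)=\{a: a\in B(r)\}$, $B^-(r)=\{a: not\,a\in B(r)\}$, $B^{--}(r)=\{a: not\,not\,a\in B(r)\}$; $\Sigma(r)$ and $\Sigma(P)$ are the sets of atoms occurring in $r$, $P$. The reduct is $P^I=\{H(r)\leftarrow B^+(r): r\in P,\ B^-(r)\cap I=\emptyset,\ B^{--}(r)\subseteq I\}$. An *HT-model* of $P$ is a pair $\langle X,Y\rangle$ with $X\subseteq Y\subseteq\Sigma(P)$, $Y\models P$ and $X\models P^Y$ (classical satisfaction, with $not$ read as classical negation); $\mathcal{HT}(P)$ is the set of all of them. $Y$ is an *answer set* of $P$ if $\langle Y,Y\rangle\in\mathcal{HT}(P)$ and there is no $X\subsetneq Y$ with $\langle X,Y\rangle\in\mathcal{HT}(P)$; $\mathcal{AS}(P)$ is the set of answer sets. For a set $\mathcal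 M$ of sets of atoms, $\mathcal M_{\parallel V}=\{X\setminus V: X\in\mathcal M\}$. **Criterion $\Omega$.** For $V,Y\subseteq \Sigma$ with $Y\cap V=\emptyset$, let $Rel^Y$ be the set of all $A\subseteq V$ with $\langle Y\cup A,Y\cup A\rangle\in\mathcal{HT}(P)$ such that no $A'\subsetneq A$ has $\langle Y\cup A',Y\cup A\rangle\in\mathcal{HT}(P)$, and let $R^{Y,A}=\{X\setminus V: \langle X,Y\cup A\rangle\in\mathcal{HT}(P)\}$. The instance $\langle P,V\rangle$ *satisfies* $\Omega$ if for some $Y\subseteq\Sigma\setminus V$ the set $\{R^{Y,A}: A\in Rel^Y\}$ is non-empty and has no least element with respect to $\subseteq$. **Normal form.** A rule $r$ is tautological if one of $H(r)\cap B^+(r)$, $B^+(r)\cap B^-(r)$, $B^-(r)\cap B^{--}(r)$ is non-empty. $NF(P)$ is obtained from $P$ by removing all tautological rules; then, in every remaining rule $r$, removing $not\,not\,a$ from the body whenever $a\in B^+(r)$ and $a$ from the head whenever $a\in B^-(r)$; and finally removing every rule $r$ that is not minimal, i.e. for which the program obtained so far contains a rule $r'$ with $H(r')\subseteq H(r)$,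 $B(r')\subseteq B(r)$ and at least one of the two inclusions strict. **Notation.** $H^{\setminus q}(r)=H(r)\setminus\{q\}$ and $B^{\setminus q}(r)=B(r)\setminus\{q,not\,q,not\,not\,q\}$. For a set $S$ of literals, $not(S)$ and $not\,not(S)$ are obtained by prefixing each element of $S$ with $not$, resp. $not\,not$, where $not\,not\,not\,a$ is simplified to $not\,a$ and $not\,not\,not\,not\,a$ to $not\,not\,a$. For a program $Q$, $\mathcal D^q(Q)$ (the *as-dual*) is the collection of all sets $not(\{l_r: r\in F\})\cup not\,not(\{l_r: r\in T\})$ where $F\cup T=Q$, $F\cap T=\emptyset$ ($F$ or $T$ may be empty), $l_r\in B^{\setminus q}(r)$ for $r\in F$ and $l_r\in H^{\setminus q}(r)$ for $r\in T$. **The operator $f_{SP}$.** Let $P'=NF(P)$ and consider the subsets of $P'$ given by $R=\{r: q\notin\Sigma(r)\}$, $R_0=\{r: q\in B(r)\}$, $R_1=\{r: not\,q\in B(r)\}$, $R_2=\{r: not\,not\,q\in B(r),\,q\notin H(r)\}$, $R_3=\{r: not\,not\,q\in B(r),\,q\in H(r)\}$, $R_4=\{r: not\,not\,q\notin B(r),\,q\in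 H(r)\}$. Then $f_{SP}(P,q)=NF(P'')$, where $P''$ consists of the rules in $R$ and of the following rules, for all $r_0\in R_0$, $r_2\in R_2$, $r_3,r_3'\in R_3$, $r_4\in R_4$, $r\in R_0\cup R_2$, $r'\in R_1\cup R_4$: - (1a) $H(r_0)\cup H^{\setminus q}(r_4)\leftarrow B^{\setminus q}(r_0)\cup B(r_4)$; - (2a) $H(r_0)\cup H^{\setminus q}(r_3)\leftarrow B^{\setminus q}(r_0)\cup B^{\setminus q}(r_3)\cup not(H^{\setminus q}(r'))\cup not\,not(B^{\setminus q}(r'))$; - (3a) $H(r_0)\leftarrow B^{\setminus q}(r_0)\cup\{not\,not\,h\}\cup D\cup B^{\setminus q}(r_3)\cup not(H^{\setminus q}(r_3))$ for $h\in H(r_0)$, $D\in\mathcal D^q((R_0\cup R_2)\setminus\{r_0\})$; - (1b) $H(r_2)\leftarrow B^{\setminus q}(r_2)\cup not(H^{\setminus q}(r_4))\cup not\,not(B(r_4))$; - (2b) $H(r_2)\leftarrow B^{\setminus q}(r_2)\cup not(H^{\setminus q}(r_3)\cup H^{\setminus q}(r'))\cup not\,not(B^{\setminus q}(r_3)\cup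 B^{\setminus q}(r'))$; - (3b) $H(r_2)\leftarrow B^{\setminus q}(r_2)\cup not(H^{\setminus q}(r_3))\cup not\,not(B^{\setminus q}(r_3)\cup\{h\})\cup D$ for $h\in H(r_2)$, $D\in\mathcal D^q((R_0\cup R_2)\setminus\{r_2\})$; - (4) $H^{\setminus q}(r')\leftarrow B^{\setminus q}(r')\cup D$ for $D\in\mathcal D^q(R_3\cup R_4)$ with $D\cap not(B^{\setminus q}(r'))=\emptyset$; - (5) $H^{\setminus q}(r')\leftarrow B^{\setminus q}(r')\cup not(H(r)\cup H^{\setminus q}(r_3))\cup not\,not(B^{\setminus q}(r)\cup B^{\setminus q}(r_3))\cup D$ for $D\in\mathcal D^q(R_4)$ with $D\cap not(B^{\setminus q}(r'))=\emptyset$; - (6) $H^{\setminus q}(r')\leftarrow B^{\setminus q}(r')\cup not(H^{\setminus q}(r_3))\cup not\,not(B^{\setminus q}(r_3)\cup\{h\})\cup D$ for $h\in H^{\setminus q}(r')$, $D\in\mathcal D^q((R_1\cup R_4)\setminus\{r'\})$; - (7) $H(r_0)\cup H^{\setminus q}(r_3)\leftarrow B^{\setminus q}(r_0)\cup B^{\setminus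 q}(r_3)\cup not(H^{\setminus q}(r_3'))\cup not\,not(B^{\setminus q}(r_3')\cup\{h\})\cup D$ for $r_3\neq r_3'$, $h\in H(r_0)$, $D\in\mathcal D^q((R_0\cup R_2)\setminus\{r_0\})$. **Theorem.** Let $P$ be a program over $\Sigma$ and $q\in\Sigma$. If $\langle P,\{q\}\rangle$ does not satisfy $\Omega$, then $f_{SP}$ satisfies strong persistence for $\langle P,\{q\}\rangle$, that is, $$\mathcal{AS}(f_{SP}(P,q)\cup R)=\mathcal{AS}(P\cup R)_{\parallel\{q\}}\quad\text{for every program } R \text{ over } \Sigma\setminus\{q\}.$$ -/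

import Mathlib

namespace ASP

/-- Body literals over a propositional signature `α`: `a`, `not a` and `not not a`. -/
inductive Literal (α : Type*) where
  | pos : α → Literal α
  | neg : α → Literal α
  | nneg : α → Literal α
  deriving DecidableEq

/-- A rule `H(r) ← B(r)`: a finite set of head atoms (read disjunctively) and a finite set of
body literals (read conjunctively). -/
@[ext]
structure Rule (α : Type*) where
  head : Finset α
  body : Finset (Literal α)
  deriving DecidableEq

/-- A logic program: a finite set of rules. -/
abbrev Program (α : Type*) := Finset (Rule α)

namespace Literal

/-- The atom of a literal. -/
def atom {α : Type*} : Literal α → α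
  | pos a => a
  | neg a => a
  | nneg a => a

/-- The literal `not l`, where `not not not a` is simplified to `not a`. -/
def negate {α : Type*} : Literal α → Literal α
  | pos a => neg a
  | neg a => nneg a
  | nneg a => neg a

/-- Classical truth of a literal in an interpretation. -/
def Holds {α : Type*} (I : Set α) : Literal α → Prop
  | pos a => a ∈ I
  | neg a => a ∉ I
  | nneg a => ¬ a ∉ I

end Literal

/-- `not (S)` for a set of literals `S`. -/
def notLits {α : Type*} [DecidableEq α] (S : Finset (Literal α)) : Finset (Literal α) :=
  S.image Literal.negate

/-- `not not (S)` for a set of literals `S`. -/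
def nnotLits {α : Type*} [DecidableEq α] (S : Finset (Literal α)) : Finset (Literal α) :=
  S.image fun l => l.negate.negate

/-- `not (A)` for a set of atoms `A`. -/
def notAtoms {α : Type*} [DecidableEq α] (A : Finset α) : Finset (Literal α) :=
  A.image Literal.neg

/-- `not not (A)` for a set of atoms `A`. -/
def nnotAtoms {α : Type*} [DecidableEq α] (A : Finset α) : Finset (Literal α) :=
  A.image Literal.nneg

namespace Rule

/-- `B⁺(r)`. -/
noncomputable def posBody {α : Type*} (r : Rule α) : Finset α :=
  r.body.preimage Literal.pos (fun _ _ _ _ h => Literal.pos.inj h)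

/-- `B⁻(r)`. -/
noncomputable def negBody {α : Type*} (r : Rule α) : Finset α :=
  r.body.preimage Literal.neg (fun _ _ _ _ h => Literal.neg.inj h)

/-- `B⁻⁻(r)`. -/
noncomputable def nnegBody {α : Type*} (r : Rule α) : Finset α :=
  r.body.preimage Literal.nneg (fun _ _ _ _ h => Literal.nneg.inj h)

/-- `Σ(r)`, the atoms occurring in `r`. -/
def atoms {α : Type*} [DecidableEq α] (r : Rule α) : Finset α :=
  r.head ∪ r.body.image Literal.atom

/-- Classical satisfaction of a rule by an interpretation. -/
def Sat {α : Type*} (I : Set α) (r : Rule α) : Prop :=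
  (∀ l ∈ r.body, l.Holds I) → ∃ a ∈ r.head, a ∈ I

/-- Tautological rules. -/
def IsTautological {α : Type*} [DecidableEq α] (r : Rule α) : Prop :=
  (r.head ∩ r.posBody).Nonempty ∨ (r.posBody ∩ r.negBody).Nonempty ∨
    (r.negBody ∩ r.nnegBody).Nonempty

/-- `H(r) \ {q}`. -/
def headWo {α : Type*} [DecidableEq α] (q : α) (r : Rule α) : Finset α :=
  r.head \ {q}

/-- `B(r) \ {q, not q, not not q}`. -/
def bodyWo {α : Type*} [DecidableEq α] (q : α) (r : Rule α) : Finset (Literal α) :=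
  r.body \ {Literal.pos q, Literal.neg q, Literal.nneg q}

/-- Remove `a` from `B⁻⁻(r)` whenever `a ∈ B⁺(r)`. -/
noncomputable def reduceBody {α : Type*} [DecidableEq α] (r : Rule α) : Rule α :=
  ⟨r.head, r.body \ nnotAtoms r.posBody⟩

/-- Remove `a` from `H(r)` whenever `a ∈ B⁻(r)`. -/
noncomputable def reduceHead {α : Type*} [DecidableEq α] (r : Rule α) : Rule α :=
  ⟨r.head \ r.negBody, r.body⟩

end Rule

namespace Program

/-- `Σ(P)`, the atoms occurring in `P`. -/
def atoms {α : Type*} [DecidableEq α] (P : Program α) : Finset α :=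
  P.biUnion Rule.atoms

/-- `I ⊨ P` in classical logic. -/
def Models {α : Type*} (I : Set α) (P : Program α) : Prop :=
  ∀ r ∈ P, r.Sat I

open Classical in
/-- The reduct `P^I`. -/
noncomputable def reduct {α : Type*} [DecidableEq α] (P : Program α) (I : Set α) : Program α :=
  (P.filter fun r => (r.negBody : Set α) ∩ I = ∅ ∧ (r.nnegBody : Set α) ⊆ I).image
    fun r => ⟨r.head, r.posBody.image Literal.pos⟩

/-- The set of HT-models `⟨X, Y⟩` of `P`, restricted to the signature of `P`. -/
def HT {α : Type*} [DecidableEq α] (P : Program α) : Set (Set α × Set α) :=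
  {M | M.1 ⊆ M.2 ∧ M.2 ⊆ (P.atoms : Set α) ∧ Models M.2 P ∧ Models M.1 (reduct P M.2)}

/-- The answer sets of `P`. -/
def AS {α : Type*} [DecidableEq α] (P : Program α) : Set (Set α) :=
  {Y | (Y, Y) ∈ HT P ∧ ¬ ∃ X, X ⊂ Y ∧ (X, Y) ∈ HT P}

/-- A rule `r` is minimal in `P`. -/
def IsMinimal {α : Type*} (P : Program α) (r : Rule α) : Prop :=
  ¬ ∃ r' ∈ P, (r'.head ⊆ r.head ∧ r'.body ⊂ r.body) ∨ (r'.head ⊂ r.head ∧ r'.body ⊆ r.body)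

open Classical in
/-- The normal form of `P`: drop tautological rules, simplify bodies, simplify heads, and finally
drop the rules that are not minimal in the resulting program. -/
noncomputable def NF {α : Type*} [DecidableEq α] (P : Program α) : Program α :=
  let P₁ : Program α := P.filter fun r => ¬ r.IsTautological
  let P₂ : Program α := P₁.image Rule.reduceBody
  let P₃ : Program α := P₂.image Rule.reduceHead
  P₃.filter fun r => P₃.IsMinimal r

/-- `R`: the rules of `P` without `q`. -/
def ruR {α : Type*} [DecidableEq α] (q : α) (P : Program α) : Program α :=
  P.filter fun r => q ∉ r.atoms

/-- `R₀`: the rules with `q` in the body. -/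
def ruR0 {α : Type*} [DecidableEq α] (q : α) (P : Program α) : Program α :=
  P.filter fun r => Literal.pos q ∈ r.body

/-- `R₁`: the rules with `not q` in the body. -/
def ruR1 {α : Type*} [DecidableEq α] (q : α) (P : Program α) : Program α :=
  P.filter fun r => Literal.neg q ∈ r.body

/-- `R₂`: the rules with `not not q` in the body and without `q` in the head. -/
def ruR2 {α : Type*} [DecidableEq α] (q : α) (P : Program α) : Program α :=
  P.filter fun r => Literal.nneg q ∈ r.body ∧ q ∉ r.head

/-- `R₃`: the rules with `not not q` in the body and `q` in the head. -/
def ruR3 {α : Type*} [DecidableEq α] (q : α) (P : Program α) : Program α :=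
  P.filter fun r => Literal.nneg q ∈ r.body ∧ q ∈ r.head

/-- `R₄`: the rules without `not not q` in the body and with `q` in the head. -/
def ruR4 {α : Type*} [DecidableEq α] (q : α) (P : Program α) : Program α :=
  P.filter fun r => Literal.nneg q ∉ r.body ∧ q ∈ r.head

/-- The as-dual of `P`: for a partition `⟨F, T⟩` of `P` (blocks may be empty), the negation of one
body literal `b r` other than those of `q` for every `r ∈ F`, and the double negation of one head
atom `h r` other than `q` for every `r ∈ T`. -/
def asDual {α : Type*} [DecidableEq α] (q : α) (P : Program α) : Set (Finset (Literal α)) :=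
  {D | ∃ (F T : Program α) (b : Rule α → Literal α) (h : Rule α → α),
    F ∪ T = P ∧ Disjoint F T ∧ (∀ r ∈ F, b r ∈ r.bodyWo q) ∧ (∀ r ∈ T, h r ∈ r.headWo q) ∧
      D = notLits (F.image b) ∪ nnotAtoms (T.image h)}

/-- The rules of the program obtained from a program `P` in normal form when forgetting `q`,
before the final normalization. -/
inductive Derived {α : Type*} [DecidableEq α] (q : α) (P : Program α) : Rule α → Prop
  | keep {r : Rule α} (hr : r ∈ ruR q P) : Derived q P r
  | d1a {r0 r4 : Rule α} (h0 : r0 ∈ ruR0 q P) (h4 : r4 ∈ ruR4 q P) :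
      Derived q P ⟨r0.head ∪ r4.headWo q, r0.bodyWo q ∪ r4.body⟩
  | d2a {r0 r3 r' : Rule α} (h0 : r0 ∈ ruR0 q P) (h3 : r3 ∈ ruR3 q P)
      (h' : r' ∈ ruR1 q P ∪ ruR4 q P) :
      Derived q P ⟨r0.head ∪ r3.headWo q,
        r0.bodyWo q ∪ r3.bodyWo q ∪ notAtoms (r'.headWo q) ∪ nnotLits (r'.bodyWo q)⟩
  | d3a {r0 r3 : Rule α} {h : α} {D : Finset (Literal α)} (h0 : r0 ∈ ruR0 q P)
      (h3 : r3 ∈ ruR3 q P) (hh : h ∈ r0.head)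
      (hD : D ∈ asDual q ((ruR0 q P ∪ ruR2 q P) \ {r0})) :
      Derived q P ⟨r0.head,
        r0.bodyWo q ∪ {Literal.nneg h} ∪ D ∪ r3.bodyWo q ∪ notAtoms (r3.headWo q)⟩
  | d1b {r2 r4 : Rule α} (h2 : r2 ∈ ruR2 q P) (h4 : r4 ∈ ruR4 q P) :
      Derived q P ⟨r2.head, r2.bodyWo q ∪ notAtoms (r4.headWo q) ∪ nnotLits r4.body⟩
  | d2b {r2 r3 r' : Rule α} (h2 : r2 ∈ ruR2 q P) (h3 : r3 ∈ ruR3 q P)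
      (h' : r' ∈ ruR1 q P ∪ ruR4 q P) :
      Derived q P ⟨r2.head,
        r2.bodyWo q ∪ notAtoms (r3.headWo q ∪ r'.headWo q) ∪
          nnotLits (r3.bodyWo q ∪ r'.bodyWo q)⟩
  | d3b {r2 r3 : Rule α} {h : α} {D : Finset (Literal α)} (h2 : r2 ∈ ruR2 q P)
      (h3 : r3 ∈ ruR3 q P) (hh : h ∈ r2.head)
      (hD : D ∈ asDual q ((ruR0 q P ∪ ruR2 q P) \ {r2})) :
      Derived q P ⟨r2.head,
        r2.bodyWo q ∪ notAtoms (r3.headWo q) ∪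
          nnotLits (r3.bodyWo q ∪ {Literal.pos h}) ∪ D⟩
  | d4 {r' : Rule α} {D : Finset (Literal α)} (h' : r' ∈ ruR1 q P ∪ ruR4 q P)
      (hD : D ∈ asDual q (ruR3 q P ∪ ruR4 q P)) (hdisj : D ∩ notLits (r'.bodyWo q) = ∅) :
      Derived q P ⟨r'.headWo q, r'.bodyWo q ∪ D⟩
  | d5 {r' r3 r : Rule α} {D : Finset (Literal α)} (h' : r' ∈ ruR1 q P ∪ ruR4 q P)
      (h3 : r3 ∈ ruR3 q P) (hr : r ∈ ruR0 q P ∪ ruR2 q P) (hD : D ∈ asDual q (ruR4 q P))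
      (hdisj : D ∩ notLits (r'.bodyWo q) = ∅) :
      Derived q P ⟨r'.headWo q,
        r'.bodyWo q ∪ notAtoms (r.head ∪ r3.headWo q) ∪
          nnotLits (r.bodyWo q ∪ r3.bodyWo q) ∪ D⟩
  | d6 {r' r3 : Rule α} {h : α} {D : Finset (Literal α)} (h' : r' ∈ ruR1 q P ∪ ruR4 q P)
      (h3 : r3 ∈ ruR3 q P) (hh : h ∈ r'.headWo q)
      (hD : D ∈ asDual q ((ruR1 q P ∪ ruR4 q P) \ {r'})) :
      Derived q P ⟨r'.headWo q,
        r'.bodyWo q ∪ notAtoms (r3.headWo q) ∪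
          nnotLits (r3.bodyWo q ∪ {Literal.pos h}) ∪ D⟩
  | d7 {r0 r3 r3' : Rule α} {h : α} {D : Finset (Literal α)} (h0 : r0 ∈ ruR0 q P)
      (h3 : r3 ∈ ruR3 q P) (h3' : r3' ∈ ruR3 q P) (hne : r3 ≠ r3')
      (hD : D ∈ asDual q ((ruR0 q P ∪ ruR2 q P) \ {r0})) (hh : h ∈ r0.head) :
      Derived q P ⟨r0.head ∪ r3.headWo q,
        r0.bodyWo q ∪ r3.bodyWo q ∪ notAtoms (r3'.headWo q) ∪
          nnotLits (r3'.bodyWo q ∪ {Literal.pos h}) ∪ D⟩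

/-- All literals over a finite set of atoms. -/
def litsOver {α : Type*} [DecidableEq α] (A : Finset α) : Finset (Literal α) :=
  A.image Literal.pos ∪ A.image Literal.neg ∪ A.image Literal.nneg

theorem mem_litsOver {α : Type*} [DecidableEq α] {A : Finset α} {l : Literal α} :
    l ∈ litsOver A ↔ l.atom ∈ A := by
  cases l <;> simp [litsOver, Literal.atom]

theorem atom_negate {α : Type*} (l : Literal α) : l.negate.atom = l.atom := by
  cases l <;> rfl

theorem finite_rules_over {α : Type*} [DecidableEq α] (A : Finset α) :
    {r : Rule α | r.head ⊆ A ∧ r.body ⊆ litsOver A}.Finite := by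
  refine Set.Finite.subset
    ((A.powerset ×ˢ (litsOver A).powerset).image fun p => Rule.mk p.1 p.2).finite_toSet ?_
  rintro ⟨h, b⟩ ⟨h1, h2⟩
  simp only [Finset.coe_image, Set.mem_image, Finset.mem_coe, Finset.mem_product,
    Finset.mem_powerset, Prod.exists]
  exact ⟨h, b, ⟨h1, h2⟩, rfl⟩

theorem finite_derived {α : Type*} [DecidableEq α] (q : α) (P : Program α) :
    {r | Derived q P r}.Finite := by
  have hH : ∀ r ∈ P, ∀ a ∈ r.head, a ∈ P.atoms := fun r hr a ha =>
    Finset.mem_biUnion.2 ⟨r, hr, Finset.mem_union_left _ ha⟩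
  have hB : ∀ r ∈ P, ∀ l ∈ r.body, l.atom ∈ P.atoms := fun r hr l hl =>
    Finset.mem_biUnion.2 ⟨r, hr, Finset.mem_union_right _ (Finset.mem_image_of_mem _ hl)⟩
  have hHW : ∀ r ∈ P, ∀ a ∈ r.headWo q, a ∈ P.atoms := fun r hr a ha =>
    hH r hr a (Finset.mem_sdiff.1 ha).1
  have hBW : ∀ r ∈ P, ∀ l ∈ r.bodyWo q, l.atom ∈ P.atoms := fun r hr l hl =>
    hB r hr l (Finset.mem_sdiff.1 hl).1
  have hD : ∀ Q : Program α, Q ⊆ P → ∀ D ∈ asDual q Q, ∀ l ∈ D, l.atom ∈ P.atoms := by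
    rintro Q hQ D ⟨F, T, b, h, rfl, -, hF, hT, rfl⟩ l hl
    rcases Finset.mem_union.1 hl with hl | hl
    · simp only [notLits, Finset.mem_image] at hl
      obtain ⟨_, ⟨r, hr, rfl⟩, rfl⟩ := hl
      rw [atom_negate]
      exact hBW r (hQ (Finset.mem_union_left _ hr)) _ (hF r hr)
    · simp only [nnotAtoms, Finset.mem_image] at hl
      obtain ⟨_, ⟨r, hr, rfl⟩, rfl⟩ := hl
      exact hHW r (hQ (Finset.mem_union_right _ hr)) _ (hT r hr)
  have hNL : ∀ S : Finset (Literal α), (∀ l ∈ S, l.atom ∈ P.atoms) →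
      ∀ l ∈ notLits S, l.atom ∈ P.atoms := by
    intro S hS l hl
    obtain ⟨m, hm, rfl⟩ := Finset.mem_image.1 hl
    rw [atom_negate]; exact hS m hm
  have hNNL : ∀ S : Finset (Literal α), (∀ l ∈ S, l.atom ∈ P.atoms) →
      ∀ l ∈ nnotLits S, l.atom ∈ P.atoms := by
    intro S hS l hl
    obtain ⟨m, hm, rfl⟩ := Finset.mem_image.1 hl
    rw [atom_negate, atom_negate]; exact hS m hm
  have hNA : ∀ S : Finset α, (∀ a ∈ S, a ∈ P.atoms) →
      ∀ l ∈ notAtoms S, l.atom ∈ P.atoms := by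
    intro S hS l hl
    obtain ⟨m, hm, rfl⟩ := Finset.mem_image.1 hl
    exact hS m hm
  have hU : ∀ S T : Finset (Literal α), (∀ l ∈ S, l.atom ∈ P.atoms) →
      (∀ l ∈ T, l.atom ∈ P.atoms) → ∀ l ∈ S ∪ T, l.atom ∈ P.atoms := fun S T hS hT l hl =>
    (Finset.mem_union.1 hl).elim (hS l) (hT l)
  have hUA : ∀ S T : Finset α, (∀ a ∈ S, a ∈ P.atoms) →
      (∀ a ∈ T, a ∈ P.atoms) → ∀ a ∈ S ∪ T, a ∈ P.atoms := fun S T hS hT l hl =>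
    (Finset.mem_union.1 hl).elim (hS l) (hT l)
  have hS1 : ∀ m : Literal α, m.atom ∈ P.atoms →
      ∀ l ∈ ({m} : Finset (Literal α)), l.atom ∈ P.atoms := fun m hm l hl => by
    rw [Finset.mem_singleton.1 hl]; exact hm
  have s0 : ruR0 q P ⊆ P := Finset.filter_subset _ _
  have s2 : ruR2 q P ⊆ P := Finset.filter_subset _ _
  have s3 : ruR3 q P ⊆ P := Finset.filter_subset _ _
  have s4 : ruR4 q P ⊆ P := Finset.filter_subset _ _
  have s14 : ruR1 q P ∪ ruR4 q P ⊆ P := Finset.union_subset (Finset.filter_subset _ _) s4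
  have s02 : ruR0 q P ∪ ruR2 q P ⊆ P := Finset.union_subset s0 s2
  have s34 : ruR3 q P ∪ ruR4 q P ⊆ P := Finset.union_subset s3 s4
  refine (finite_rules_over P.atoms).subset fun r hr => ?_
  suffices h : (∀ a ∈ r.head, a ∈ P.atoms) ∧ ∀ l ∈ r.body, l.atom ∈ P.atoms from
    ⟨h.1, fun l hl => mem_litsOver.2 (h.2 l hl)⟩
  cases hr with
  | keep hr =>
    have := Finset.filter_subset _ _ hr
    exact ⟨hH r this, hB r this⟩
  | d1a h0 h4 =>
    exact ⟨hUA _ _ (hH _ (s0 h0)) (hHW _ (s4 h4)), hU _ _ (hBW _ (s0 h0)) (hB _ (s4 h4))⟩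
  | d2a h0 h3 h' =>
    exact ⟨hUA _ _ (hH _ (s0 h0)) (hHW _ (s3 h3)),
      hU _ _ (hU _ _ (hU _ _ (hBW _ (s0 h0)) (hBW _ (s3 h3))) (hNA _ (hHW _ (s14 h'))))
        (hNNL _ (hBW _ (s14 h')))⟩
  | d3a h0 h3 hh hd =>
    exact ⟨fun a ha => hH _ (s0 h0) a ha, hU _ _ (hU _ _ (hU _ _ (hU _ _ (hBW _ (s0 h0))
      (hS1 _ (hH _ (s0 h0) _ hh))) (hD _ (Finset.sdiff_subset.trans s02) _ hd))
        (hBW _ (s3 h3))) (hNA _ (hHW _ (s3 h3)))⟩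
  | d1b h2 h4 =>
    exact ⟨fun a ha => hH _ (s2 h2) a ha, hU _ _ (hU _ _ (hBW _ (s2 h2)) (hNA _ (hHW _ (s4 h4))))
      (hNNL _ (hB _ (s4 h4)))⟩
  | d2b h2 h3 h' =>
    exact ⟨fun a ha => hH _ (s2 h2) a ha, hU _ _ (hU _ _ (hBW _ (s2 h2))
      (hNA _ (hUA _ _ (hHW _ (s3 h3)) (hHW _ (s14 h')))))
        (hNNL _ (hU _ _ (hBW _ (s3 h3)) (hBW _ (s14 h'))))⟩
  | d3b h2 h3 hh hd =>
    exact ⟨fun a ha => hH _ (s2 h2) a ha, hU _ _ (hU _ _ (hU _ _ (hBW _ (s2 h2)) (hNA _ (hHW _ (s3 h3))))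
      (hNNL _ (hU _ _ (hBW _ (s3 h3)) (hS1 _ (hH _ (s2 h2) _ hh)))))
        (hD _ (Finset.sdiff_subset.trans s02) _ hd)⟩
  | d4 h' hd _ =>
    exact ⟨hHW _ (s14 h'), hU _ _ (hBW _ (s14 h')) (hD _ s34 _ hd)⟩
  | d5 h' h3 hr hd _ =>
    exact ⟨hHW _ (s14 h'), hU _ _ (hU _ _ (hU _ _ (hBW _ (s14 h'))
      (hNA _ (hUA _ _ (hH _ (s02 hr)) (hHW _ (s3 h3)))))
        (hNNL _ (hU _ _ (hBW _ (s02 hr)) (hBW _ (s3 h3))))) (hD _ s4 _ hd)⟩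
  | d6 h' h3 hh hd =>
    exact ⟨hHW _ (s14 h'), hU _ _ (hU _ _ (hU _ _ (hBW _ (s14 h')) (hNA _ (hHW _ (s3 h3))))
      (hNNL _ (hU _ _ (hBW _ (s3 h3)) (hS1 _ (hHW _ (s14 h') _ hh)))))
        (hD _ (Finset.sdiff_subset.trans s14) _ hd)⟩
  | d7 h0 h3 h3' _ hd hh =>
    exact ⟨hUA _ _ (hH _ (s0 h0)) (hHW _ (s3 h3)),
      hU _ _ (hU _ _ (hU _ _ (hU _ _ (hBW _ (s0 h0)) (hBW _ (s3 h3)))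
        (hNA _ (hHW _ (s3 h3')))) (hNNL _ (hU _ _ (hBW _ (s3 h3')) (hS1 _ (hH _ (s0 h0) _ hh)))))
        (hD _ (Finset.sdiff_subset.trans s02) _ hd)⟩

/-- The forgetting operator `f_SP(P, q)`. -/
noncomputable def fSP {α : Type*} [DecidableEq α] (P : Program α) (q : α) : Program α :=
  NF (finite_derived q (NF P)).toFinset

/-- `R^{Y,A}` for the forgetting instance `⟨P, V⟩`. -/
def RYA {α : Type*} [DecidableEq α] (P : Program α) (V Y A : Set α) : Set (Set α) :=
  {Z | ∃ X, (X, Y ∪ A) ∈ HT P ∧ Z = X \ V}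

/-- `Rel^Y` for the forgetting instance `⟨P, V⟩`. -/
def Rel {α : Type*} [DecidableEq α] (P : Program α) (V Y : Set α) : Set (Set α) :=
  {A | A ⊆ V ∧ (Y ∪ A, Y ∪ A) ∈ HT P ∧ ¬ ∃ A', A' ⊂ A ∧ (Y ∪ A', Y ∪ A) ∈ HT P}

/-- The set of sets `{R^{Y,A} | A ∈ Rel^Y}`. -/
def RY {α : Type*} [DecidableEq α] (P : Program α) (V Y : Set α) : Set (Set (Set α)) :=
  {S | ∃ A ∈ Rel P V Y, S = RYA P V Y A}

/-- The forgetting instance `⟨P, V⟩` satisfies criterion `Ω`. -/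
def SatisfiesOmega {α : Type*} [DecidableEq α] (P : Program α) (V : Set α) : Prop :=
  ∃ Y : Set α, Y ⊆ Vᶜ ∧ (RY P V Y).Nonempty ∧ ¬ ∃ S, IsLeast (RY P V Y) S

/-- The `V`-exclusion of a set of interpretations. -/
def exclusion {α : Type*} (M : Set (Set α)) (V : Set α) : Set (Set α) :=
  {Z | ∃ X ∈ M, Z = X \ V}

/-- An operator `f` forgetting single atoms satisfies strong persistence for `⟨P, {q}⟩`. -/
def StronglyPersistent {α : Type*} [DecidableEq α] (f : Program α → α → Program α)
    (P : Program α) (q : α) : Prop :=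
  ∀ R : Program α, q ∉ R.atoms → AS (f P q ∪ R) = exclusion (AS (P ∪ R)) {q}

end Program

end ASP

/-! Fix `Y` with `q ∉ Y`. Only `∅` and `{q}` can belong to `Rel^Y`, so criterion `Ω` fails exactly
when, for every such `Y` where both are relevant, the sets `R^{Y,∅}` and `R^{Y,{q}}` are comparable.
The heart of the proof is `htSat_fSP_iff`, which needs no assumption on `Ω`: for `X ⊆ Y`, the pair
`⟨X, Y⟩` satisfies `f_SP(P, q)` iff `Rel^Y` is non-empty and `X` lies in every relevant `R^{Y,A}`
(`Remains`). Adding a program without `q` merely intersects the sets of models. If the two relevant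
sets are comparable, their intersection is one of them, and minimality of `Y` for the forgotten
program is minimality of `Y` or of `Y ∪ {q}` for the original one. Conversely, an answer set of `P ∪
R` always survives, since the intersection is contained in each relevant set
(`mem_AS_fSP_union_iff`).

For `htSat_fSP_iff`, normalization changes no HT-model (`htSat_NF`), so `P` may be taken reduced.
Satisfaction of `P` at `⟨X, Y⟩`, `⟨X, Y ∪ {q}⟩` and `⟨X ∪ {q}, Y ∪ {q}⟩` then says that certain of
the classes `R`, `R₀`, ..., `R₄`, stripped of `q`, hold at `⟨X, Y⟩`. `Remains` thus becomes a
Boolean combination of such statements, `ForgetCond`. Negated literals and as-duals let a rule body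
test which classes hold at `⟨Y, Y⟩`, and each derived rule is an implication from such a test to a
constraint on `X`. Soundness is `ForgetCond.htSat_of_derived`, completeness `forgetCond_of_derived`.
-/

namespace ASP

variable {α : Type*}

/-! ### HT-semantics without a fixed signature. -/

namespace Literal

/-- Truth of a literal in the HT-interpretation `⟨X, Y⟩`. -/
def HTHolds (X Y : Set α) : Literal α → Prop
  | pos a => a ∈ X
  | neg a => a ∉ Y
  | nneg a => a ∈ Y

theorem holds_iff_htHolds (Y : Set α) (l : Literal α) : l.Holds Y ↔ l.HTHolds Y Y := by
  cases l <;> simp [Holds, HTHolds]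

theorem HTHolds.mono {X X' Y : Set α} (h : X ⊆ X') {l : Literal α} (hl : l.HTHolds X Y) :
    l.HTHolds X' Y := by
  cases l <;> simp_all [HTHolds]
  exact h hl

/-- Negated literals see only the second component. This is how the body of a derived rule tests `Y`
while the rule constrains `X`. -/
theorem htHolds_negate_iff (X Y : Set α) (l : Literal α) :
    l.negate.HTHolds X Y ↔ ¬ l.HTHolds Y Y := by
  cases l <;> simp [negate, HTHolds]

theorem htHolds_congr {X Y X' Y' : Set α} {l : Literal α} (hX : l.atom ∈ X ↔ l.atom ∈ X')
    (hY : l.atom ∈ Y ↔ l.atom ∈ Y') : l.HTHolds X Y ↔ l.HTHolds X' Y' := by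
  cases l <;> simp_all [atom, HTHolds]

end Literal

/-- All literals of `S` are true in the HT-interpretation `⟨X, Y⟩`. -/
def BodyHolds (X Y : Set α) (S : Finset (Literal α)) : Prop :=
  ∀ l ∈ S, l.HTHolds X Y

/-- Some atom of `A` is true in `X`. -/
def HeadHolds (X : Set α) (A : Finset α) : Prop :=
  ∃ a ∈ A, a ∈ X

theorem BodyHolds.mono {X X' Y : Set α} (h : X ⊆ X') {S : Finset (Literal α)}
    (hS : BodyHolds X Y S) : BodyHolds X' Y S :=
  fun l hl => (hS l hl).mono h

theorem HeadHolds.mono {X X' : Set α} (h : X ⊆ X') {A : Finset α} (hA : HeadHolds X A) :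
    HeadHolds X' A :=
  let ⟨a, ha, haX⟩ := hA; ⟨a, ha, h haX⟩

section lits

variable [DecidableEq α] {X Y : Set α}

theorem bodyHolds_union {S T : Finset (Literal α)} :
    BodyHolds X Y (S ∪ T) ↔ BodyHolds X Y S ∧ BodyHolds X Y T := by
  simp only [BodyHolds, Finset.mem_union, or_imp, forall_and]

omit [DecidableEq α] in
theorem bodyHolds_singleton {l : Literal α} : BodyHolds X Y {l} ↔ l.HTHolds X Y := by
  simp [BodyHolds]

theorem headHolds_union {A B : Finset α} :
    HeadHolds X (A ∪ B) ↔ HeadHolds X A ∨ HeadHolds X B := by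
  simp only [HeadHolds, Finset.mem_union, or_and_right, exists_or]

theorem bodyHolds_notAtoms {A : Finset α} : BodyHolds X Y (notAtoms A) ↔ ¬ HeadHolds Y A := by
  simp [BodyHolds, HeadHolds, notAtoms, Literal.HTHolds]

theorem bodyHolds_nnotLits {S : Finset (Literal α)} :
    BodyHolds X Y (nnotLits S) ↔ BodyHolds Y Y S := by
  simp [BodyHolds, nnotLits, Literal.htHolds_negate_iff]

end lits

namespace Rule

/-- The condition that `r` imposes on the first component of the HT-interpretation `⟨X, Y⟩`. -/
def HTSat (X Y : Set α) (r : Rule α) : Prop :=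
  BodyHolds X Y r.body → HeadHolds X r.head

theorem sat_iff_htSat (Y : Set α) (r : Rule α) : r.Sat Y ↔ r.HTSat Y Y := by
  simp only [Sat, HTSat, BodyHolds, HeadHolds, Literal.holds_iff_htHolds]

theorem HTSat.of_subset {X Y : Set α} {r r' : Rule α} (h : r'.HTSat X Y)
    (hh : r'.head ⊆ r.head) (hb : r'.body ⊆ r.body) : r.HTSat X Y := fun hB =>
  let ⟨a, ha, haX⟩ := h fun l hl => hB l (hb hl)
  ⟨a, hh ha, haX⟩

theorem htSat_congr [DecidableEq α] {X Y X' Y' : Set α} {r : Rule α}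
    (hX : ∀ a ∈ r.atoms, a ∈ X ↔ a ∈ X') (hY : ∀ a ∈ r.atoms, a ∈ Y ↔ a ∈ Y') :
    r.HTSat X Y ↔ r.HTSat X' Y' := by
  have hb : BodyHolds X Y r.body ↔ BodyHolds X' Y' r.body := forall₂_congr fun l hl =>
    have := Finset.mem_union_right r.head (Finset.mem_image_of_mem Literal.atom hl)
    Literal.htHolds_congr (hX _ this) (hY _ this)
  have hh : HeadHolds X r.head ↔ HeadHolds X' r.head := exists_congr fun a =>
    and_congr_right fun ha => hX a (Finset.mem_union_left _ ha)
  rw [HTSat, HTSat, hb, hh]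

theorem mem_posBody {r : Rule α} {a : α} : a ∈ r.posBody ↔ Literal.pos a ∈ r.body :=
  Finset.mem_preimage

theorem mem_negBody {r : Rule α} {a : α} : a ∈ r.negBody ↔ Literal.neg a ∈ r.body :=
  Finset.mem_preimage

theorem mem_nnegBody {r : Rule α} {a : α} : a ∈ r.nnegBody ↔ Literal.nneg a ∈ r.body :=
  Finset.mem_preimage

end Rule

namespace Program

/-- Satisfaction of a program by the HT-interpretation `⟨X, Y⟩`, over any signature. -/
def HTSat (X Y : Set α) (P : Program α) : Prop :=
  ∀ r ∈ P, r.HTSat Y Y ∧ r.HTSat X Y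

variable [DecidableEq α]

theorem htSat_union {X Y : Set α} {P Q : Program α} :
    HTSat X Y (P ∪ Q) ↔ P.HTSat X Y ∧ Q.HTSat X Y := by
  constructor
  · exact fun h => ⟨fun r hr => h r (Finset.mem_union_left _ hr),
      fun r hr => h r (Finset.mem_union_right _ hr)⟩
  · exact fun h r hr => (Finset.mem_union.1 hr).elim (h.1 r) (h.2 r)

theorem htSat_congr {P : Program α} {X Y X' Y' : Set α} (hX : ∀ a ∈ P.atoms, a ∈ X ↔ a ∈ X')
    (hY : ∀ a ∈ P.atoms, a ∈ Y ↔ a ∈ Y') : P.HTSat X Y ↔ P.HTSat X' Y' := by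
  refine forall₂_congr fun r hr => ?_
  have h : ∀ a ∈ r.atoms, a ∈ P.atoms := fun a ha => Finset.mem_biUnion.2 ⟨r, hr, ha⟩
  rw [Rule.htSat_congr (fun a ha => hY a (h a ha)) (fun a ha => hY a (h a ha)),
    Rule.htSat_congr (fun a ha => hX a (h a ha)) (fun a ha => hY a (h a ha))]

theorem htSat_inter_atoms {P : Program α} {X Y : Set α} :
    P.HTSat (X ∩ P.atoms) (Y ∩ P.atoms) ↔ P.HTSat X Y :=
  htSat_congr (by simp +contextual) (by simp +contextual)

theorem htSat_diff_singleton {P : Program α} {q : α} (hq : q ∉ P.atoms) {X Y : Set α} :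
    P.HTSat (X \ {q}) (Y \ {q}) ↔ P.HTSat X Y := by
  have h : ∀ a ∈ P.atoms, a ≠ q := fun a ha e => hq (e ▸ ha)
  exact htSat_congr (by simp +contextual [h]) (by simp +contextual [h])

/-- The `neg` and `nneg` literals decide whether a rule survives in the reduct, the `pos` literals
are what remains of its body; together they are the HT-reading of the body, so reducts are not
needed afterwards. -/
theorem models_reduct_iff {P : Program α} {X Y : Set α} :
    Models X (reduct P Y) ↔ ∀ r ∈ P, r.HTSat X Y := by
  simp only [Models, reduct, Finset.mem_image, Finset.mem_filter, forall_exists_index, and_imp]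
  constructor
  · intro h r hr hb
    refine h ⟨r.head, r.posBody.image Literal.pos⟩ r hr ?_ ?_ rfl ?_
    · rw [← Set.disjoint_iff_inter_eq_empty, Set.disjoint_left]
      intro a ha
      exact hb (.neg a) (Rule.mem_negBody.1 ha)
    · intro a ha
      exact hb (.nneg a) (Rule.mem_nnegBody.1 ha)
    · simp only [Finset.mem_image]
      rintro _ ⟨a, ha, rfl⟩
      exact hb (.pos a) (Rule.mem_posBody.1 ha)
  · rintro h _ r hr h1 h2 rfl hb
    rw [← Set.disjoint_iff_inter_eq_empty, Set.disjoint_left] at h1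
    refine h r hr ?_
    rintro (a | a | a) hl
    · exact hb (.pos a) (Finset.mem_image_of_mem _ (Rule.mem_posBody.2 hl))
    · exact h1 (Rule.mem_negBody.2 hl)
    · exact h2 (Rule.mem_nnegBody.2 hl)

theorem mem_HT_iff {P : Program α} {X Y : Set α} :
    (X, Y) ∈ HT P ↔ X ⊆ Y ∧ Y ⊆ P.atoms ∧ P.HTSat X Y := by
  rw [HT, Set.mem_ofPred_eq, models_reduct_iff]
  simp only [Models, Rule.sat_iff_htSat, HTSat, forall₂_and]

/-- The signature bound is redundant because minimality enforces it. This matters since `P`, `P ∪ R`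
and the forgotten program have different signatures. -/
theorem mem_AS_iff {P : Program α} {Y : Set α} :
    Y ∈ AS P ↔ P.HTSat Y Y ∧ ∀ X, X ⊂ Y → ¬ P.HTSat X Y := by
  simp only [AS, Set.mem_ofPred_eq, mem_HT_iff, subset_rfl, true_and, not_exists, not_and]
  constructor
  · rintro ⟨⟨h1, h2⟩, h3⟩
    exact ⟨h2, fun X hX => h3 X hX hX.subset h1⟩
  · rintro ⟨h1, h2⟩
    refine ⟨⟨?_, h1⟩, fun X hX _ _ => h2 X hX⟩
    by_contra h
    -- Deleting from the first component the atoms foreign to `P` preserves satisfaction,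
    -- contradicting minimality.
    refine h2 (Y ∩ P.atoms) ⟨Set.inter_subset_left, fun h' => h fun a ha => (h' ha).2⟩ ?_
    rwa [htSat_congr (X' := Y) (Y' := Y) (by simp +contextual) (by simp)]

end Program

/-! ### Normalization preserves HT-models. -/

namespace Rule

variable [DecidableEq α]

theorem IsTautological.htSat {r : Rule α} (h : r.IsTautological) {X Y : Set α} (hXY : X ⊆ Y) :
    r.HTSat X Y := by
  intro hb
  rcases h with ⟨a, ha⟩ | ⟨a, ha⟩ | ⟨a, ha⟩ <;>
    simp only [Finset.mem_inter, mem_posBody, mem_negBody, mem_nnegBody] at ha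
  · exact ⟨a, ha.1, hb _ ha.2⟩
  · exact absurd (hXY (hb _ ha.1)) (hb _ ha.2)
  · exact absurd (hb _ ha.2) (hb _ ha.1)

theorem htSat_reduceBody {r : Rule α} {X Y : Set α} (hXY : X ⊆ Y) :
    r.reduceBody.HTSat X Y ↔ r.HTSat X Y := by
  have : BodyHolds X Y r.reduceBody.body ↔ BodyHolds X Y r.body := by
    refine ⟨fun h l hl => ?_, fun h l hl => h l (Finset.mem_sdiff.1 hl).1⟩
    by_cases hl' : l ∈ nnotAtoms r.posBody
    · obtain ⟨a, ha, rfl⟩ := Finset.mem_image.1 hl'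
      refine hXY (h (.pos a) (Finset.mem_sdiff.2 ⟨mem_posBody.1 ha, ?_⟩))
      simp [nnotAtoms]
    · exact h l (Finset.mem_sdiff.2 ⟨hl, hl'⟩)
  rw [HTSat, HTSat, this]
  rfl

theorem htSat_reduceHead {r : Rule α} {X Y : Set α} (hXY : X ⊆ Y) :
    r.reduceHead.HTSat X Y ↔ r.HTSat X Y := by
  refine forall_congr' fun hb => ⟨fun ⟨a, ha, haX⟩ => ⟨a, (Finset.mem_sdiff.1 ha).1, haX⟩, ?_⟩
  rintro ⟨a, ha, haX⟩
  exact ⟨a, Finset.mem_sdiff.2 ⟨ha, fun h => hb _ (mem_negBody.1 h) (hXY haX)⟩, haX⟩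

/-- No atom occurs twice in `r`, except for `not not a` in the body together with `a` in the
head. -/
structure IsReduced (r : Rule α) : Prop where
  pos_head : ∀ a, Literal.pos a ∈ r.body → a ∉ r.head
  neg_head : ∀ a, Literal.neg a ∈ r.body → a ∉ r.head
  pos_neg : ∀ a, Literal.pos a ∈ r.body → Literal.neg a ∉ r.body
  pos_nneg : ∀ a, Literal.pos a ∈ r.body → Literal.nneg a ∉ r.body
  neg_nneg : ∀ a, Literal.neg a ∈ r.body → Literal.nneg a ∉ r.body

theorem isReduced_reduceHead_reduceBody {r : Rule α} (h : ¬ r.IsTautological) :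
    r.reduceBody.reduceHead.IsReduced := by
  simp only [IsTautological, not_or, Finset.not_nonempty_iff_eq_empty,
    Finset.eq_empty_iff_forall_notMem, Finset.mem_inter, mem_posBody, mem_negBody,
    mem_nnegBody, not_and] at h
  obtain ⟨h1, h2, h3⟩ := h
  constructor <;> intro a <;>
    simp only [reduceHead, reduceBody, nnotAtoms, Finset.mem_sdiff, Finset.mem_image, mem_negBody,
      mem_posBody] <;> grind

end Rule

namespace Program

variable [DecidableEq α]

omit [DecidableEq α] in
-- Replacing a non-minimal rule by a smaller one lowers the total number of head atoms and body
-- literals, so descent terminates.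
theorem exists_minimal_le (P : Program α) {r : Rule α} (hr : r ∈ P) :
    ∃ r' ∈ P, P.IsMinimal r' ∧ r'.head ⊆ r.head ∧ r'.body ⊆ r.body := by
  induction h : r.head.card + r.body.card using Nat.strong_induction_on generalizing r with
  | _ n ih =>
    by_cases hm : P.IsMinimal r
    · exact ⟨r, hr, hm, subset_rfl, subset_rfl⟩
    · obtain ⟨r', hr', hlt⟩ := not_not.1 hm
      have hle : r'.head ⊆ r.head ∧ r'.body ⊆ r.body :=
        hlt.elim (fun h => ⟨h.1, h.2.subset⟩) fun h => ⟨h.1.subset, h.2⟩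
      have hcard : r'.head.card + r'.body.card < n := by
        rw [← h]
        rcases hlt with ⟨h1, h2⟩ | ⟨h1, h2⟩
        · exact add_lt_add_of_le_of_lt (Finset.card_le_card h1) (Finset.card_lt_card h2)
        · exact add_lt_add_of_lt_of_le (Finset.card_lt_card h1) (Finset.card_le_card h2)
      obtain ⟨s, hs, hsm, h1, h2⟩ := ih _ hcard hr' rfl
      exact ⟨s, hs, hsm, h1.trans hle.1, h2.trans hle.2⟩

theorem mem_NF_imp {P : Program α} {r : Rule α} (hr : r ∈ NF P) :
    ∃ s ∈ P, ¬ s.IsTautological ∧ s.reduceBody.reduceHead = r := by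
  simp only [NF, Finset.mem_filter, Finset.mem_image] at hr
  obtain ⟨⟨_, ⟨s, ⟨hs, hst⟩, rfl⟩, rfl⟩, -⟩ := hr
  exact ⟨s, hs, hst, rfl⟩

theorem isReduced_of_mem_NF {P : Program α} {r : Rule α} (hr : r ∈ NF P) : r.IsReduced := by
  obtain ⟨s, -, hs, rfl⟩ := mem_NF_imp hr
  exact Rule.isReduced_reduceHead_reduceBody hs

theorem exists_mem_NF_le {P : Program α} {r : Rule α} (hr : r ∈ P) (ht : ¬ r.IsTautological) :
    ∃ s ∈ NF P, s.head ⊆ r.reduceBody.reduceHead.head ∧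
      s.body ⊆ r.reduceBody.reduceHead.body := by
  classical
  have hmem : r.reduceBody.reduceHead ∈
      ((P.filter fun r => ¬ r.IsTautological).image Rule.reduceBody).image Rule.reduceHead :=
    Finset.mem_image_of_mem _ (Finset.mem_image_of_mem _ (Finset.mem_filter.2 ⟨hr, ht⟩))
  obtain ⟨s, hs, hsm, h⟩ := exists_minimal_le _ hmem
  refine ⟨s, ?_, h⟩
  simp only [NF, Finset.mem_filter]
  refine ⟨?_, ?_⟩
  · convert hs
  · convert hsm

/-- Tautologies hold wherever `X ⊆ Y`, both simplifications are equivalences there, and a deleted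
non-minimal rule is implied by a minimal one below it. -/
theorem htSat_NF {P : Program α} {X Y : Set α} (hXY : X ⊆ Y) :
    (NF P).HTSat X Y ↔ P.HTSat X Y := by
  have key : ∀ Z, Z ⊆ Y → ((∀ r ∈ NF P, r.HTSat Z Y) ↔ ∀ r ∈ P, r.HTSat Z Y) := by
    refine fun Z hZ => ⟨fun h r hr => ?_, fun h r hr => ?_⟩
    · by_cases ht : r.IsTautological
      · exact ht.htSat hZ
      · obtain ⟨s, hs, h1, h2⟩ := exists_mem_NF_le hr ht
        rw [← Rule.htSat_reduceBody hZ, ← Rule.htSat_reduceHead hZ]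
        exact (h s hs).of_subset h1 h2
    · obtain ⟨s, hs, -, rfl⟩ := mem_NF_imp hr
      rw [Rule.htSat_reduceHead hZ, Rule.htSat_reduceBody hZ]
      exact h s hs
  simp only [HTSat, forall₂_and, key Y subset_rfl, key X hXY]

end Program

variable [DecidableEq α]

/-! ### Stripping `q` from rules. -/

namespace Rule

theorem mem_headWo {q a : α} {r : Rule α} : a ∈ r.headWo q ↔ a ∈ r.head ∧ a ≠ q := by
  simp [headWo]

theorem mem_bodyWo {q : α} {l : Literal α} {r : Rule α} :
    l ∈ r.bodyWo q ↔ l ∈ r.body ∧ l.atom ≠ q := by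
  cases l <;> simp [bodyWo, Literal.atom]

/-- The condition that `r`, with all literals of `q` removed, imposes on the first component of
the HT-interpretation `⟨X, Y⟩`. -/
def Good (q : α) (X Y : Set α) (r : Rule α) : Prop :=
  BodyHolds X Y (r.bodyWo q) → HeadHolds X (r.headWo q)

/-- Separates the literals of `q` from the rest. Describing `X'` and `Y'` only up to `q` lets one
statement cover every way of adding `q` to `X` and `Y`. -/
theorem htSat_iff_of_diff {q : α} {X Y X' Y' : Set α} (hX : X' \ {q} = X) (hY : Y' \ {q} = Y)
    (r : Rule α) :
    r.HTSat X' Y' ↔ ((Literal.pos q ∈ r.body → q ∈ X') → (Literal.neg q ∈ r.body → q ∉ Y') →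
      (Literal.nneg q ∈ r.body → q ∈ Y') → ¬ (q ∈ r.head ∧ q ∈ X') → r.Good q X Y) := by
  subst hX hY
  have hb : BodyHolds X' Y' r.body ↔ (Literal.pos q ∈ r.body → q ∈ X') ∧
      (Literal.neg q ∈ r.body → q ∉ Y') ∧ (Literal.nneg q ∈ r.body → q ∈ Y') ∧
        BodyHolds (X' \ {q}) (Y' \ {q}) (r.bodyWo q) := by
    constructor
    · refine fun h => ⟨h _, h _, h _, fun l hl => ?_⟩
      rw [mem_bodyWo] at hl
      exact (Literal.htHolds_congr (by simp [hl.2]) (by simp [hl.2])).1 (h l hl.1)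
    · rintro ⟨h1, h2, h3, h⟩ l hl
      by_cases hq : l.atom = q
      · rcases l with a | a | a <;> obtain rfl : a = q := hq
        exacts [h1 hl, h2 hl, h3 hl]
      · exact (Literal.htHolds_congr (by simp [hq]) (by simp [hq])).1 (h l (mem_bodyWo.2 ⟨hl, hq⟩))
  have hh : HeadHolds X' r.head ↔ (q ∈ r.head ∧ q ∈ X') ∨ HeadHolds (X' \ {q}) (r.headWo q) := by
    constructor
    · rintro ⟨a, ha, haX⟩
      by_cases hq : a = q
      · exact .inl (hq ▸ ⟨ha, haX⟩)
      · exact .inr ⟨a, mem_headWo.2 ⟨ha, hq⟩, haX, hq⟩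
    · rintro (⟨ha, haX⟩ | ⟨a, ha, haX, -⟩)
      · exact ⟨q, ha, haX⟩
      · exact ⟨a, (mem_headWo.1 ha).1, haX⟩
  rw [HTSat, hb, hh, Good]
  constructor
  · exact fun h h1 h2 h3 h4 h5 => (h ⟨h1, h2, h3, h5⟩).resolve_left h4
  · exact fun h ⟨h1, h2, h3, h5⟩ => or_iff_not_imp_left.2 fun h4 => h h1 h2 h3 h4 h5

theorem headWo_eq {q : α} {r : Rule α} (h : q ∉ r.head) : r.headWo q = r.head :=
  (Finset.sdiff_singleton_eq_erase q r.head).trans (Finset.erase_eq_of_notMem h)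

theorem bodyWo_eq {q : α} {r : Rule α} (h1 : Literal.pos q ∉ r.body)
    (h2 : Literal.neg q ∉ r.body) (h3 : Literal.nneg q ∉ r.body) : r.bodyWo q = r.body := by
  ext l
  rw [mem_bodyWo, and_iff_left_iff_imp]
  rintro hl rfl
  rcases l with a | a | a
  exacts [h1 hl, h2 hl, h3 hl]

theorem mem_atoms {q : α} {r : Rule α} : q ∈ r.atoms ↔
    q ∈ r.head ∨ Literal.pos q ∈ r.body ∨ Literal.neg q ∈ r.body ∨ Literal.nneg q ∈ r.body := by
  rw [atoms, Finset.mem_union, Finset.mem_image]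
  refine or_congr_right ⟨?_, ?_⟩
  · rintro ⟨a | a | a, hl, rfl⟩ <;> simp [Literal.atom, hl]
  · rintro (h | h | h)
    exacts [⟨_, h, rfl⟩, ⟨_, h, rfl⟩, ⟨_, h, rfl⟩]

end Rule

namespace Program

/-- All rules of `Q`, with all literals of `q` removed, are satisfied by `⟨X, Y⟩`. -/
def AllGood (q : α) (X Y : Set α) (Q : Program α) : Prop :=
  ∀ r ∈ Q, r.Good q X Y

theorem allGood_union {q : α} {X Y : Set α} {Q Q' : Program α} :
    AllGood q X Y (Q ∪ Q') ↔ AllGood q X Y Q ∧ AllGood q X Y Q' := by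
  constructor
  · exact fun h => ⟨fun r hr => h r (Finset.mem_union_left _ hr),
      fun r hr => h r (Finset.mem_union_right _ hr)⟩
  · exact fun h r hr => (Finset.mem_union.1 hr).elim (h.1 r) (h.2 r)

/-- Accounts for the derived rules whose as-dual omits one rule: the literal `not not h`, with `h`
in the head of that rule, already makes it good at `Y`. -/
theorem allGood_sdiff_singleton {q : α} {Y : Set α} {Q : Program α} {r : Rule α}
    (hr : r.Good q Y Y) : AllGood q Y Y (Q \ {r}) ↔ AllGood q Y Y Q := by
  refine ⟨fun h s hs => ?_, fun h s hs => h s (Finset.mem_sdiff.1 hs).1⟩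
  by_cases e : s = r
  · exact e ▸ hr
  · exact h s (by simp [hs, e])

/-! ### The as-dual as a disjunctive normal form of `AllGood q Y Y Q`. -/

theorem allGood_of_mem_asDual {q : α} {X Y : Set α} {Q : Program α} {D : Finset (Literal α)}
    (hD : D ∈ asDual q Q) (h : BodyHolds X Y D) : AllGood q Y Y Q := by
  obtain ⟨F, T, b, g, rfl, -, hF, hT, rfl⟩ := hD
  rw [bodyHolds_union] at h
  intro r hr hb
  rcases Finset.mem_union.1 hr with hr | hr
  · exact absurd (hb _ (hF r hr)) ((Literal.htHolds_negate_iff X Y _).1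
      (h.1 _ (Finset.mem_image_of_mem _ (Finset.mem_image_of_mem _ hr))))
  · exact ⟨g r, hT r hr, h.2 _ (Finset.mem_image_of_mem _ (Finset.mem_image_of_mem _ hr))⟩

/-- Each stripped rule is good at `Y` because a body literal fails or a head atom holds. The
witnesses, with `F` the rules whose stripped body fails, form the required `D`. -/
theorem exists_mem_asDual {q : α} {Y : Set α} {Q : Program α} (h : AllGood q Y Y Q) (X : Set α) :
    ∃ D ∈ asDual q Q, BodyHolds X Y D := by
  classical
  have hF : ∀ r : Rule α, ∃ l : Literal α, ¬ BodyHolds Y Y (r.bodyWo q) →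
      l ∈ r.bodyWo q ∧ ¬ l.HTHolds Y Y := by
    intro r
    by_cases hb : BodyHolds Y Y (r.bodyWo q)
    -- A dummy value: the selectors must be defined on all rules but are used only where a genuine
    -- witness exists.
    · exact ⟨.pos q, fun h => absurd hb h⟩
    · simp only [BodyHolds, not_forall] at hb
      obtain ⟨l, hl, hlY⟩ := hb
      exact ⟨l, fun _ => ⟨hl, hlY⟩⟩
  have hT : ∀ r : Rule α, ∃ a : α, HeadHolds Y (r.headWo q) → a ∈ r.headWo q ∧ a ∈ Y := by
    intro r
    by_cases hb : HeadHolds Y (r.headWo q)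
    · obtain ⟨a, ha⟩ := hb
      exact ⟨a, fun _ => ha⟩
    · exact ⟨q, fun h => absurd h hb⟩
  choose b hb using hF
  choose g hg using hT
  have hT' : ∀ r ∈ Q.filter (fun r => ¬ ¬ BodyHolds Y Y (r.bodyWo q)),
      HeadHolds Y (r.headWo q) := fun r hr =>
    h r (Finset.mem_filter.1 hr).1 (not_not.1 (Finset.mem_filter.1 hr).2)
  refine ⟨_, ⟨Q.filter (fun r => ¬ BodyHolds Y Y (r.bodyWo q)),
    Q.filter (fun r => ¬ ¬ BodyHolds Y Y (r.bodyWo q)), b, g, Finset.filter_union_filter_not_eq _ _,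
    Finset.disjoint_filter_filter_not _ _ _, fun r hr => (hb r (Finset.mem_filter.1 hr).2).1,
    fun r hr => (hg r (hT' r hr)).1, rfl⟩, ?_⟩
  rw [bodyHolds_union]
  constructor
  · intro l hl
    simp only [notLits, Finset.mem_image] at hl
    obtain ⟨_, ⟨r, hr, rfl⟩, rfl⟩ := hl
    exact (Literal.htHolds_negate_iff X Y _).2 (hb r (Finset.mem_filter.1 hr).2).2
  · intro l hl
    simp only [nnotAtoms, Finset.mem_image] at hl
    obtain ⟨_, ⟨r, hr, rfl⟩, rfl⟩ := hl
    exact (hg r (hT' r hr)).2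

/-- The disjointness side conditions of `d4` and `d5` only discard rules whose body cannot hold. -/
theorem inter_notLits_eq_empty {X Y : Set α} (hXY : X ⊆ Y) {D S : Finset (Literal α)}
    (hD : BodyHolds X Y D) (hS : BodyHolds X Y S) : D ∩ notLits S = ∅ := by
  simp only [Finset.eq_empty_iff_forall_notMem, Finset.mem_inter, notLits, Finset.mem_image]
  rintro _ ⟨hl, l, hlS, rfl⟩
  exact (Literal.htHolds_negate_iff X Y l).1 (hD _ hl) (hS.mono hXY l hlS)

/-! ### Which rule classes matter at each placement of `q`. -/

section reduced

variable {q : α} {P : Program α} {X Y : Set α}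

/-- With `q` false in both components, the bodies of `R₀`, `R₂` and `R₃` fail. -/
theorem forall_htSat_iff (hP : ∀ r ∈ P, r.IsReduced) (hX : q ∉ X) (hY : q ∉ Y) :
    (∀ r ∈ P, r.HTSat X Y) ↔ AllGood q X Y (ruR q P) ∧ AllGood q X Y (ruR1 q P ∪ ruR4 q P) := by
  have h : ∀ r : Rule α, r.HTSat X Y ↔ _ := Rule.htSat_iff_of_diff (Set.sdiff_singleton_eq_self hX)
    (Set.sdiff_singleton_eq_self hY)
  rw [allGood_union]
  simp only [AllGood, ruR, ruR1, ruR4, Finset.mem_filter, Rule.mem_atoms, h]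
  constructor
  · intro H
    refine ⟨fun r hr => ?_, fun r hr => ?_, fun r hr => ?_⟩ <;> have := hP r hr.1 <;>
      have := this.pos_head q <;> have := (hP r hr.1).neg_head q <;>
      have := (hP r hr.1).pos_neg q <;> have := (hP r hr.1).neg_nneg q <;>
      have := H r hr.1 <;> clear H <;> grind
  · rintro ⟨H1, H2, H3⟩ r hr
    have := H1 r
    have := H2 r
    have := H3 r
    have := (hP r hr).pos_head q
    clear H1 hP
    grind

/-- With `q` only in the second component, the bodies of `R₀` and `R₁` fail, and `q` in a head does
not help. -/
theorem forall_htSat_insert_right_iff (hP : ∀ r ∈ P, r.IsReduced) (hX : q ∉ X) (hY : q ∉ Y) :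
    (∀ r ∈ P, r.HTSat X (insert q Y)) ↔ AllGood q X Y (ruR q P) ∧ AllGood q X Y (ruR2 q P) ∧
      AllGood q X Y (ruR3 q P ∪ ruR4 q P) := by
  have h : ∀ r : Rule α, r.HTSat X (insert q Y) ↔ _ :=
    Rule.htSat_iff_of_diff (Set.sdiff_singleton_eq_self hX) (Set.insert_sdiff_self_of_notMem hY)
  rw [allGood_union]
  simp only [AllGood, ruR, ruR2, ruR3, ruR4, Finset.mem_filter, Rule.mem_atoms, h,
    Set.mem_insert_iff, true_or]
  constructor
  · intro H
    refine ⟨fun r hr => ?_, fun r hr => ?_, fun r hr => ?_, fun r hr => ?_⟩ <;>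
      have := (hP r hr.1).pos_head q <;> have := (hP r hr.1).neg_head q <;>
      have := (hP r hr.1).pos_nneg q <;> have := (hP r hr.1).neg_nneg q <;>
      have := H r hr.1 <;> clear H <;> grind
  · rintro ⟨H1, H2, H3, H4⟩ r hr
    have := H1 r
    have := H2 r
    have := H3 r
    have := H4 r
    have := (hP r hr).pos_head q
    clear H1 hP
    grind

/-- With `q` in both components, the bodies of `R₁` fail and the heads of `R₃` and `R₄` hold. -/
theorem forall_htSat_insert_insert_iff (hP : ∀ r ∈ P, r.IsReduced) (hX : q ∉ X) (hY : q ∉ Y) :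
    (∀ r ∈ P, r.HTSat (insert q X) (insert q Y)) ↔
      AllGood q X Y (ruR q P) ∧ AllGood q X Y (ruR0 q P ∪ ruR2 q P) := by
  have h : ∀ r : Rule α, r.HTSat (insert q X) (insert q Y) ↔ _ :=
    Rule.htSat_iff_of_diff (Set.insert_sdiff_self_of_notMem hX) (Set.insert_sdiff_self_of_notMem hY)
  rw [allGood_union]
  simp only [AllGood, ruR, ruR0, ruR2, Finset.mem_filter, Rule.mem_atoms, h,
    Set.mem_insert_iff, true_or]
  constructor
  · intro H
    refine ⟨fun r hr => ?_, fun r hr => ?_, fun r hr => ?_⟩ <;>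
      have := (hP r hr.1).pos_head q <;> have := (hP r hr.1).neg_head q <;>
      have := (hP r hr.1).pos_neg q <;> have := (hP r hr.1).neg_nneg q <;>
      have := H r hr.1 <;> clear H <;> grind
  · rintro ⟨H1, H2, H3⟩ r hr
    have := H1 r
    have := H2 r
    have := H3 r
    have := (hP r hr).pos_head q
    clear H1 hP
    grind

end reduced

end Program

/-! ### The forgetting condition, and soundness of the derived rules. -/

namespace Rule

theorem Good.of_head {q : α} {X Y : Set α} {r : Rule α} (h : HeadHolds X (r.headWo q)) :
    r.Good q X Y := fun _ => h

theorem not_good_iff {q : α} {X Y : Set α} {r : Rule α} :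
    ¬ r.Good q X Y ↔ BodyHolds X Y (r.bodyWo q) ∧ ¬ HeadHolds X (r.headWo q) := by
  rw [Good, Classical.not_imp]

end Rule

namespace Program

variable {q : α} {P : Program α} {X Y : Set α}

theorem not_allGood_iff {Q : Program α} :
    ¬ AllGood q X Y Q ↔
      ∃ r ∈ Q, BodyHolds X Y (r.bodyWo q) ∧ ¬ HeadHolds X (r.headWo q) := by
  simp only [AllGood, not_forall, Rule.not_good_iff, exists_prop]

theorem not_allGood_of_mem {Q : Program α} {r : Rule α} (hr : r ∈ Q)
    (hb : BodyHolds X Y (r.bodyWo q)) (hh : ¬ HeadHolds X (r.headWo q)) : ¬ AllGood q X Y Q :=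
  not_allGood_iff.2 ⟨r, hr, hb, hh⟩

theorem headWo_of_mem_ruR {r : Rule α} (hr : r ∈ ruR q P) : r.headWo q = r.head :=
  Rule.headWo_eq fun h => (Finset.mem_filter.1 hr).2 (Rule.mem_atoms.2 (.inl h))

theorem bodyWo_of_mem_ruR {r : Rule α} (hr : r ∈ ruR q P) : r.bodyWo q = r.body := by
  have h := (Finset.mem_filter.1 hr).2
  rw [Rule.mem_atoms] at h
  push Not at h
  exact Rule.bodyWo_eq h.2.1 h.2.2.1 h.2.2.2

theorem headWo_of_mem_ruR0 (hP : ∀ r ∈ P, r.IsReduced) {r : Rule α} (hr : r ∈ ruR0 q P) :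
    r.headWo q = r.head :=
  Rule.headWo_eq ((hP r (Finset.mem_filter.1 hr).1).pos_head q (Finset.mem_filter.1 hr).2)

theorem headWo_of_mem_ruR2 {r : Rule α} (hr : r ∈ ruR2 q P) : r.headWo q = r.head :=
  Rule.headWo_eq (Finset.mem_filter.1 hr).2.2

theorem bodyWo_of_mem_ruR4 (hP : ∀ r ∈ P, r.IsReduced) {r : Rule α} (hr : r ∈ ruR4 q P) :
    r.bodyWo q = r.body := by
  obtain ⟨hr, h1, h2⟩ := Finset.mem_filter.1 hr
  exact Rule.bodyWo_eq (fun h => (hP r hr).pos_head q h h2) (fun h => (hP r hr).neg_head q h h2) h1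

/-- The HT-interpretations that remain when `q` is forgotten from a program `P` in normal form. -/
structure ForgetCond (q : α) (P : Program α) (X Y : Set α) : Prop where
  rest : AllGood q X Y (ruR q P)
  total : AllGood q Y Y (ruR1 q P ∪ ruR4 q P) ∨
    AllGood q Y Y (ruR0 q P ∪ ruR2 q P) ∧ ¬ AllGood q Y Y (ruR3 q P ∪ ruR4 q P)
  without : AllGood q Y Y (ruR1 q P ∪ ruR4 q P) → AllGood q X Y (ruR1 q P ∪ ruR4 q P)
  insert : AllGood q Y Y (ruR0 q P ∪ ruR2 q P) → ¬ AllGood q Y Y (ruR3 q P ∪ ruR4 q P) →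
    AllGood q X Y (ruR2 q P) ∧ (AllGood q X Y (ruR0 q P) ∨ AllGood q X Y (ruR3 q P ∪ ruR4 q P))

/-- The part of each body evaluated at `Y` either refutes one alternative of `total` or directly
supplies the premises of `without` or `insert`; the resulting constraint on `X` yields the head. -/
theorem ForgetCond.htSat_of_derived (h : ForgetCond q P X Y) (hP : ∀ r ∈ P, r.IsReduced)
    (hXY : X ⊆ Y) {r : Rule α} (hr : Derived q P r) : r.HTSat X Y := by
  have dual_insert : ∀ {Q : Program α} {r : Rule α} {D : Finset (Literal α)} {a : α},
      D ∈ asDual q (Q \ {r}) → BodyHolds X Y D → a ∈ r.headWo q → a ∈ Y → AllGood q Y Y Q :=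
    fun hD hb ha haY => (allGood_sdiff_singleton (.of_head ⟨_, ha, haY⟩)).1
      (allGood_of_mem_asDual hD hb)
  have l3 : ∀ {r}, r ∈ ruR3 q P → r ∈ ruR3 q P ∪ ruR4 q P := Finset.mem_union_left _
  have l4 : ∀ {r}, r ∈ ruR4 q P → r ∈ ruR3 q P ∪ ruR4 q P := Finset.mem_union_right _
  have l14 : ∀ {r}, r ∈ ruR4 q P → r ∈ ruR1 q P ∪ ruR4 q P := Finset.mem_union_right _
  intro hb
  cases hr with
  | keep hr =>
    have := h.rest _ hr
    rw [Rule.Good, headWo_of_mem_ruR hr, bodyWo_of_mem_ruR hr] at this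
    exact this hb
  | d1a h0 h4 =>
    rw [← bodyWo_of_mem_ruR4 hP h4, ← headWo_of_mem_ruR0 hP h0] at *
    rw [bodyHolds_union] at hb
    rw [headHolds_union]
    rcases h.total with hA | ⟨hB, hE⟩
    · exact .inr (h.without hA _ (l14 h4) hb.2)
    · exact (h.insert hB hE).2.imp (fun H => H _ h0 hb.1) fun H => H _ (l4 h4) hb.2
  | d2a h0 h3 h' =>
    rw [← headWo_of_mem_ruR0 hP h0]
    simp only [bodyHolds_union, bodyHolds_notAtoms, bodyHolds_nnotLits] at hb
    rw [headHolds_union]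
    obtain ⟨hB, hE⟩ := h.total.resolve_left (not_allGood_of_mem h' hb.2 hb.1.2)
    exact (h.insert hB hE).2.imp (fun H => H _ h0 hb.1.1.1) fun H => H _ (l3 h3) hb.1.1.2
  | d3a h0 h3 hh hD =>
    rw [← headWo_of_mem_ruR0 hP h0] at *
    simp only [bodyHolds_union, bodyHolds_notAtoms, bodyHolds_singleton] at hb
    obtain ⟨⟨⟨⟨h1, h2⟩, h3'⟩, h4⟩, h5⟩ := hb
    -- The alternative that `R₃ ∪ R₄` is good at `X` is impossible: it would make the head of `r3`
    -- true in `X ⊆ Y`, against `not (H(r3))`.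
    refine ((h.insert (dual_insert hD h3' hh h2)
      (not_allGood_of_mem (l3 h3) (h4.mono hXY) h5)).2.resolve_right fun H => ?_) _ h0 h1
    exact h5 ((H _ (l3 h3) h4).mono hXY)
  | d1b h2 h4 =>
    rw [← bodyWo_of_mem_ruR4 hP h4] at *
    rw [← headWo_of_mem_ruR2 h2]
    simp only [bodyHolds_union, bodyHolds_notAtoms, bodyHolds_nnotLits] at hb
    obtain ⟨hB, hE⟩ := h.total.resolve_left (not_allGood_of_mem (l14 h4) hb.2 hb.1.2)
    exact (h.insert hB hE).1 _ h2 hb.1.1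
  | d2b h2 h3 h' =>
    rw [← headWo_of_mem_ruR2 h2]
    simp only [bodyHolds_union, bodyHolds_notAtoms, bodyHolds_nnotLits, headHolds_union,
      not_or] at hb
    obtain ⟨hB, hE⟩ := h.total.resolve_left (not_allGood_of_mem h' hb.2.2 hb.1.2.2)
    exact (h.insert hB hE).1 _ h2 hb.1.1
  | d3b h2 h3 hh hD =>
    rw [← headWo_of_mem_ruR2 h2] at *
    simp only [bodyHolds_union, bodyHolds_notAtoms, bodyHolds_nnotLits, bodyHolds_singleton] at hb
    obtain ⟨⟨⟨h1, h3'⟩, h4, h5⟩, h6⟩ := hb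
    exact (h.insert (dual_insert hD h6 hh h5) (not_allGood_of_mem (l3 h3) h4 h3')).1 _ h2 h1
  | d4 h' hD _ =>
    rw [bodyHolds_union] at hb
    exact h.without (h.total.resolve_right fun H => H.2 (allGood_of_mem_asDual hD hb.2)) _ h' hb.1
  | @d5 r' r3 r D h' h3 hr hD _ =>
    have hw : r.headWo q = r.head := (Finset.mem_union.1 hr).elim (headWo_of_mem_ruR0 hP)
      headWo_of_mem_ruR2
    rw [← hw] at hb
    simp only [bodyHolds_union, bodyHolds_notAtoms, bodyHolds_nnotLits, headHolds_union,
      not_or] at hb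
    obtain ⟨⟨⟨h1, h2, -⟩, h4, -⟩, -⟩ := hb
    exact h.without (h.total.resolve_right fun H => not_allGood_of_mem hr h4 h2 H.1) _ h' h1
  | d6 h' h3 hh hD =>
    simp only [bodyHolds_union, bodyHolds_notAtoms, bodyHolds_nnotLits, bodyHolds_singleton] at hb
    obtain ⟨⟨⟨h1, -⟩, -, h5⟩, h6⟩ := hb
    exact h.without (dual_insert hD h6 hh h5) _ h' h1
  | d7 h0 h3 h3' _ hD hh =>
    rw [← headWo_of_mem_ruR0 hP h0] at *
    simp only [bodyHolds_union, bodyHolds_notAtoms, bodyHolds_nnotLits, bodyHolds_singleton] at hb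
    rw [headHolds_union]
    obtain ⟨⟨⟨⟨h1, h2⟩, h4⟩, h5, h6⟩, h7⟩ := hb
    exact (h.insert (dual_insert hD h7 hh h6) (not_allGood_of_mem (l3 h3') h5 h4)).2.imp
      (fun H => H _ h0 h1) fun H => H _ (l3 h3) h2

/-! ### Completeness of the derived rules. -/

section derived

variable (hP : ∀ r ∈ P, r.IsReduced) (hXY : X ⊆ Y)

-- `d1a` resolves a rule of `R₀` against one of `R₄` on `q`; a violation on both sides would violate
-- the resolvent.
include hP in
theorem ruR0_or_ruR4_of_derived (h : ∀ r, Derived q P r → r.HTSat X Y) :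
    AllGood q X Y (ruR0 q P) ∨ AllGood q X Y (ruR4 q P) := by
  refine or_iff_not_imp_left.2 fun h0 r4 h4 hb4 => ?_
  obtain ⟨r0, hr0, hb0, hh0⟩ := not_allGood_iff.1 h0
  have := h _ (.d1a hr0 h4)
  rw [Rule.HTSat, bodyHolds_union, headHolds_union, ← bodyWo_of_mem_ruR4 hP h4,
    ← headWo_of_mem_ruR0 hP hr0] at this
  exact (this ⟨hb0, hb4⟩).resolve_left hh0

include hP in
theorem ruR0_or_ruR3_of_derived (h : ∀ r, Derived q P r → r.HTSat X Y)
    (hA : ¬ AllGood q Y Y (ruR1 q P ∪ ruR4 q P)) :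
    AllGood q X Y (ruR0 q P) ∨ AllGood q X Y (ruR3 q P) := by
  refine or_iff_not_imp_left.2 fun h0 r3 h3 hb3 => ?_
  obtain ⟨r0, hr0, hb0, hh0⟩ := not_allGood_iff.1 h0
  obtain ⟨r', hr', hb', hh'⟩ := not_allGood_iff.1 hA
  have := h _ (.d2a hr0 h3 hr')
  simp only [Rule.HTSat, bodyHolds_union, headHolds_union, bodyHolds_notAtoms, bodyHolds_nnotLits,
    ← headWo_of_mem_ruR0 hP hr0] at this
  exact (this ⟨⟨⟨hb0, hb3⟩, hh'⟩, hb'⟩).resolve_left hh0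

-- A violated `r0` has its body true at `Y` too, so `hB` supplies a head atom true in `Y`: the `h`
-- that replaces `r0` in the as-dual.
include hP hXY in
theorem ruR0_or_ruR3_of_derived' (h : ∀ r, Derived q P r → r.HTSat X Y)
    (hB : AllGood q Y Y (ruR0 q P ∪ ruR2 q P)) (hE : ¬ AllGood q Y Y (ruR3 q P)) :
    AllGood q X Y (ruR0 q P) ∨ AllGood q X Y (ruR3 q P) := by
  refine or_iff_not_imp_left.2 fun h0 r3 h3 hb3 => ?_
  obtain ⟨r0, hr0, hb0, hh0⟩ := not_allGood_iff.1 h0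
  obtain ⟨r3', h3', hb3', hh3'⟩ := not_allGood_iff.1 hE
  obtain ⟨a, ha, haY⟩ := hB r0 (Finset.mem_union_left _ hr0) (hb0.mono hXY)
  obtain ⟨D, hD, hDX⟩ := exists_mem_asDual
    (fun r hr => hB r (Finset.mem_sdiff.1 hr).1 : AllGood q Y Y ((ruR0 q P ∪ ruR2 q P) \ {r0})) X
  rw [headWo_of_mem_ruR0 hP hr0] at *
  -- If the head of `r3` holds in `Y`, then `r3` differs from the violated `r3'` and `d7` applies;
  -- otherwise `r3` can itself play the role of the violated rule in `d3a`.
  by_cases hh3 : HeadHolds Y (r3.headWo q)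
  · have := h _ (.d7 hr0 h3 h3' (fun e => hh3' (e ▸ hh3)) hD ha)
    simp only [Rule.HTSat, bodyHolds_union, headHolds_union, bodyHolds_notAtoms,
      bodyHolds_nnotLits, bodyHolds_singleton] at this
    exact (this ⟨⟨⟨⟨hb0, hb3⟩, hh3'⟩, hb3', haY⟩, hDX⟩).resolve_left hh0
  · have := h _ (.d3a hr0 h3 ha hD)
    simp only [Rule.HTSat, bodyHolds_union, bodyHolds_notAtoms, bodyHolds_singleton] at this
    exact absurd (this ⟨⟨⟨⟨hb0, haY⟩, hDX⟩, hb3⟩, hh3⟩) hh0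

-- A rule of `R₄` violated at `Y` feeds `d1b`; one of `R₃` needs the witness of `hA` as well and
-- feeds `d2b`.
include hP in
theorem ruR2_of_derived (h : ∀ r, Derived q P r → r.HTSat X Y)
    (hA : ¬ AllGood q Y Y (ruR1 q P ∪ ruR4 q P)) (hE : ¬ AllGood q Y Y (ruR3 q P ∪ ruR4 q P)) :
    AllGood q X Y (ruR2 q P) := by
  intro r2 h2 hb2
  rw [headWo_of_mem_ruR2 h2]
  rw [allGood_union, not_and_or] at hE
  obtain hE | hE := hE.symm <;> obtain ⟨r, hr, hb, hh⟩ := not_allGood_iff.1 hE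
  · have := h _ (.d1b h2 hr)
    simp only [Rule.HTSat, bodyHolds_union, bodyHolds_notAtoms, bodyHolds_nnotLits,
      ← bodyWo_of_mem_ruR4 hP hr] at this
    exact this ⟨⟨hb2, hh⟩, hb⟩
  · obtain ⟨r', hr', hb', hh'⟩ := not_allGood_iff.1 hA
    have := h _ (.d2b h2 hr hr')
    simp only [Rule.HTSat, bodyHolds_union, bodyHolds_notAtoms, bodyHolds_nnotLits,
      headHolds_union, not_or] at this
    exact this ⟨⟨hb2, hh, hh'⟩, hb, hb'⟩

include hXY in
theorem ruR2_of_derived' (h : ∀ r, Derived q P r → r.HTSat X Y)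
    (hB : AllGood q Y Y (ruR0 q P ∪ ruR2 q P)) (hE : ¬ AllGood q Y Y (ruR3 q P)) :
    AllGood q X Y (ruR2 q P) := by
  intro r2 h2 hb2
  obtain ⟨r3, h3, hb3, hh3⟩ := not_allGood_iff.1 hE
  obtain ⟨a, ha, haY⟩ := hB r2 (Finset.mem_union_right _ h2) (hb2.mono hXY)
  obtain ⟨D, hD, hDX⟩ := exists_mem_asDual
    (fun r hr => hB r (Finset.mem_sdiff.1 hr).1 : AllGood q Y Y ((ruR0 q P ∪ ruR2 q P) \ {r2})) X
  rw [headWo_of_mem_ruR2 h2] at *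
  have := h _ (.d3b h2 h3 ha hD)
  simp only [Rule.HTSat, bodyHolds_union, bodyHolds_notAtoms, bodyHolds_nnotLits,
    bodyHolds_singleton] at this
  exact this ⟨⟨⟨hb2, hh3⟩, hb3, haY⟩, hDX⟩

include hXY in
theorem ruR1_ruR4_of_derived (h : ∀ r, Derived q P r → r.HTSat X Y)
    (hE : AllGood q Y Y (ruR3 q P ∪ ruR4 q P)) : AllGood q X Y (ruR1 q P ∪ ruR4 q P) := by
  intro r' h' hb'
  obtain ⟨D, hD, hDX⟩ := exists_mem_asDual hE X
  exact h _ (.d4 h' hD (inter_notLits_eq_empty hXY hDX hb')) (bodyHolds_union.2 ⟨hb', hDX⟩)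

include hP hXY in
theorem ruR1_ruR4_of_derived' (h : ∀ r, Derived q P r → r.HTSat X Y)
    (h3 : ¬ AllGood q Y Y (ruR3 q P)) (h4 : AllGood q Y Y (ruR4 q P))
    (hB : ¬ AllGood q Y Y (ruR0 q P ∪ ruR2 q P)) : AllGood q X Y (ruR1 q P ∪ ruR4 q P) := by
  intro r' h' hb'
  obtain ⟨r3, hr3, hb3, hh3⟩ := not_allGood_iff.1 h3
  obtain ⟨r, hr, hb, hh⟩ := not_allGood_iff.1 hB
  obtain ⟨D, hD, hDX⟩ := exists_mem_asDual h4 X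
  have hw : r.headWo q = r.head := (Finset.mem_union.1 hr).elim (headWo_of_mem_ruR0 hP)
    headWo_of_mem_ruR2
  have := h _ (.d5 h' hr3 hr hD (inter_notLits_eq_empty hXY hDX hb'))
  simp only [Rule.HTSat, bodyHolds_union, bodyHolds_notAtoms, bodyHolds_nnotLits,
    headHolds_union, not_or, ← hw] at this
  exact this ⟨⟨⟨hb', hh, hh3⟩, hb, hb3⟩, hDX⟩

include hXY in
theorem ruR1_ruR4_of_derived'' (h : ∀ r, Derived q P r → r.HTSat X Y)
    (h3 : ¬ AllGood q Y Y (ruR3 q P)) (hA : AllGood q Y Y (ruR1 q P ∪ ruR4 q P)) :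
    AllGood q X Y (ruR1 q P ∪ ruR4 q P) := by
  intro r' h' hb'
  obtain ⟨r3, hr3, hb3, hh3⟩ := not_allGood_iff.1 h3
  obtain ⟨a, ha, haY⟩ := hA r' h' (hb'.mono hXY)
  obtain ⟨D, hD, hDX⟩ := exists_mem_asDual
    (fun r hr => hA r (Finset.mem_sdiff.1 hr).1 : AllGood q Y Y ((ruR1 q P ∪ ruR4 q P) \ {r'})) X
  have := h _ (.d6 h' hr3 ha hD)
  simp only [Rule.HTSat, bodyHolds_union, bodyHolds_notAtoms, bodyHolds_nnotLits,
    bodyHolds_singleton] at this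
  exact this ⟨⟨⟨hb', hh3⟩, hb3, haY⟩, hDX⟩

include hP hXY in
theorem forgetCond_of_derived (hX : ∀ r, Derived q P r → r.HTSat X Y)
    (hY : ∀ r, Derived q P r → r.HTSat Y Y) : ForgetCond q P X Y := by
  have h34 := @allGood_union α _ q Y Y (ruR3 q P) (ruR4 q P)
  have h02 := @allGood_union α _ q Y Y (ruR0 q P) (ruR2 q P)
  have h14 := @allGood_union α _ q Y Y (ruR1 q P) (ruR4 q P)
  constructor
  · intro r hr hb
    rw [bodyWo_of_mem_ruR hr] at hb
    rw [headWo_of_mem_ruR hr]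
    exact hX r (.keep hr) hb
  -- If both alternatives fail, `d4` excludes that `R₃ ∪ R₄` is good, hence `R₀ ∪ R₂` is not, and
  -- `d5` excludes that `R₄` is good. Then `d1a`, `d1b` and `d2b` force `R₀ ∪ R₂` to be good, a
  -- contradiction.
  · by_contra! H
    obtain ⟨hA, H⟩ := H
    have hE : ¬ AllGood q Y Y (ruR3 q P ∪ ruR4 q P) :=
      fun hE => hA (ruR1_ruR4_of_derived subset_rfl hY hE)
    have hB : ¬ AllGood q Y Y (ruR0 q P ∪ ruR2 q P) := fun hB => hE (H hB)
    have h4 : ¬ AllGood q Y Y (ruR4 q P) := fun h4 =>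
      hA (ruR1_ruR4_of_derived' hP subset_rfl hY (fun h3 => hE (h34.2 ⟨h3, h4⟩)) h4 hB)
    exact hB (h02.2 ⟨(ruR0_or_ruR4_of_derived hP hY).resolve_right h4,
      ruR2_of_derived hP hY hA hE⟩)
  · intro hA
    by_cases h3 : AllGood q Y Y (ruR3 q P)
    · exact ruR1_ruR4_of_derived hXY hX (h34.2 ⟨h3, (h14.1 hA).2⟩)
    · exact ruR1_ruR4_of_derived'' hXY hX h3 hA
  · intro hB hE
    rw [allGood_union]
    by_cases hA : AllGood q Y Y (ruR1 q P ∪ ruR4 q P)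
    · have h3 : ¬ AllGood q Y Y (ruR3 q P) := fun h3 => hE (h34.2 ⟨h3, (h14.1 hA).2⟩)
      have h4 := ruR0_or_ruR4_of_derived hP hX
      have h3' := ruR0_or_ruR3_of_derived' hP hXY hX hB h3
      exact ⟨ruR2_of_derived' hXY hX hB h3, by tauto⟩
    · have h4 := ruR0_or_ruR4_of_derived hP hX
      have h3 := ruR0_or_ruR3_of_derived hP hX hA
      exact ⟨ruR2_of_derived hP hX hA hE, by tauto⟩

end derived

end Program

/-! ### HT-models of the forgotten program in terms of relevant sets. -/

namespace Program

variable {q : α} {P : Program α} {X Y : Set α}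

/-- `∅ ∈ Rel^Y`, over any signature. -/
def RelEmpty (P : Program α) (Y : Set α) : Prop :=
  P.HTSat Y Y

/-- `{q} ∈ Rel^Y`, over any signature. -/
def RelInsert (q : α) (P : Program α) (Y : Set α) : Prop :=
  P.HTSat (insert q Y) (insert q Y) ∧ ¬ P.HTSat Y (insert q Y)

/-- `X ∈ R^{Y,{q}}`, over any signature. -/
def MemInsert (q : α) (P : Program α) (X Y : Set α) : Prop :=
  P.HTSat X (insert q Y) ∨ P.HTSat (insert q X) (insert q Y)

/-- `Rel^Y` is non-empty, and `X` is in the intersection of the sets `R^{Y,A}`, `A ∈ Rel^Y`. -/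
structure Remains (q : α) (P : Program α) (X Y : Set α) : Prop where
  total : P.RelEmpty Y ∨ P.RelInsert q Y
  without : P.RelEmpty Y → P.HTSat X Y
  insert : P.RelInsert q Y → P.MemInsert q X Y

omit [DecidableEq α] in
theorem MemInsert.self (h : P.RelInsert q Y) : P.MemInsert q Y Y :=
  .inr h.1

/-- Purely propositional once the three class descriptions are inserted. The condition at `⟨Y, Y⟩`
is included because it carries the requirement that `R` hold at `Y`, which `ForgetCond q P X Y` does
not state. -/
theorem forgetCond_iff (hP : ∀ r ∈ P, r.IsReduced) (hX : q ∉ X) (hY : q ∉ Y) :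
    ForgetCond q P X Y ∧ ForgetCond q P Y Y ↔ P.Remains q X Y := by
  have e1 := forall_htSat_iff hP hX hY
  have e2 := forall_htSat_iff hP hY hY
  have e3 := forall_htSat_insert_right_iff hP hX hY
  have e4 := forall_htSat_insert_right_iff hP hY hY
  have e5 := forall_htSat_insert_insert_iff hP hX hY
  have e6 := forall_htSat_insert_insert_iff hP hY hY
  have f1 : P.HTSat X Y ↔ _ := forall₂_and.trans (and_congr e2 e1)
  have f2 : P.HTSat Y Y ↔ _ := forall₂_and.trans (and_congr e2 e2)
  have f3 : P.HTSat X (insert q Y) ↔ _ := forall₂_and.trans (and_congr e6 e3)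
  have f4 : P.HTSat Y (insert q Y) ↔ _ := forall₂_and.trans (and_congr e6 e4)
  have f5 : P.HTSat (insert q X) (insert q Y) ↔ _ := forall₂_and.trans (and_congr e6 e5)
  have f6 : P.HTSat (insert q Y) (insert q Y) ↔ _ := forall₂_and.trans (and_congr e6 e6)
  have h02 := @allGood_union α _ q Y Y (ruR0 q P) (ruR2 q P)
  have h02' := @allGood_union α _ q X Y (ruR0 q P) (ruR2 q P)
  constructor
  · rintro ⟨⟨a1, a2, a3, a4⟩, ⟨b1, b2, b3, b4⟩⟩
    constructor <;> simp only [RelEmpty, RelInsert, MemInsert, f1, f2, f3, f4, f5, f6] <;>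
      clear f1 f2 f3 f4 f5 f6 e1 e2 e3 e4 e5 e6 <;> grind
  · rintro ⟨a1, a2, a3⟩
    simp only [RelEmpty, RelInsert, MemInsert, f1, f2, f3, f4, f5, f6] at a1 a2 a3
    clear f1 f2 f3 f4 f5 f6 e1 e2 e3 e4 e5 e6
    constructor <;> constructor <;> grind

theorem remains_NF (hXY : X ⊆ Y) : (NF P).Remains q X Y ↔ P.Remains q X Y := by
  have h1 : (NF P).RelEmpty Y ↔ P.RelEmpty Y := htSat_NF subset_rfl
  have h2 : (NF P).RelInsert q Y ↔ P.RelInsert q Y :=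
    and_congr (htSat_NF subset_rfl) (not_congr (htSat_NF (Set.subset_insert q Y)))
  have h3 : (NF P).MemInsert q X Y ↔ P.MemInsert q X Y :=
    or_congr (htSat_NF (hXY.trans (Set.subset_insert q Y)))
      (htSat_NF (Set.insert_subset_insert hXY))
  have h4 := htSat_NF (P := P) hXY
  constructor
  · rintro ⟨a1, a2, a3⟩
    exact ⟨by rwa [← h1, ← h2], by rwa [← h1, ← h4], by rwa [← h2, ← h3]⟩
  · rintro ⟨a1, a2, a3⟩
    exact ⟨by rwa [h1, h2], by rwa [h1, h4], by rwa [h2, h3]⟩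

/-- The HT-models of `f_SP(P, q)`. -/
theorem htSat_fSP_iff (hY : q ∉ Y) (hXY : X ⊆ Y) :
    (fSP P q).HTSat X Y ↔ P.Remains q X Y := by
  have hP : ∀ r ∈ NF P, r.IsReduced := fun r => isReduced_of_mem_NF
  rw [fSP, htSat_NF hXY, ← remains_NF hXY, ← forgetCond_iff hP (fun h => hY (hXY h)) hY]
  simp only [HTSat, Set.Finite.mem_toFinset, Set.mem_ofPred_eq]
  constructor
  · exact fun h => ⟨forgetCond_of_derived hP hXY (fun r hr => (h r hr).2) fun r hr => (h r hr).1,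
      forgetCond_of_derived hP subset_rfl (fun r hr => (h r hr).1) fun r hr => (h r hr).1⟩
  · exact fun h r hr => ⟨h.2.htSat_of_derived hP subset_rfl hr, h.1.htSat_of_derived hP hXY hr⟩

/-! ### The atom `q` disappears. -/

theorem atom_ne_of_mem_asDual {Q : Program α} {D : Finset (Literal α)} (hD : D ∈ asDual q Q)
    {l : Literal α} (hl : l ∈ D) : l.atom ≠ q := by
  obtain ⟨F, T, b, h, -, -, hF, hT, rfl⟩ := hD
  rcases Finset.mem_union.1 hl with hl | hl
  · simp only [notLits, Finset.mem_image] at hl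
    obtain ⟨_, ⟨r, hr, rfl⟩, rfl⟩ := hl
    rw [atom_negate]
    exact (Rule.mem_bodyWo.1 (hF r hr)).2
  · simp only [nnotAtoms, Finset.mem_image] at hl
    obtain ⟨_, ⟨r, hr, rfl⟩, rfl⟩ := hl
    exact (Rule.mem_headWo.1 (hT r hr)).2

/-- `q` does not occur in the set `S` of literals. -/
def Avoids (q : α) (S : Finset (Literal α)) : Prop :=
  ∀ l ∈ S, l.atom ≠ q

theorem avoids_union {S T : Finset (Literal α)} : Avoids q (S ∪ T) ↔ Avoids q S ∧ Avoids q T := by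
  simp only [Avoids, Finset.mem_union, or_imp, forall_and]

theorem avoids_bodyWo (r : Rule α) : Avoids q (r.bodyWo q) :=
  fun _ hl => (Rule.mem_bodyWo.1 hl).2

theorem avoids_notAtoms {A : Finset α} (hA : q ∉ A) : Avoids q (notAtoms A) := by
  rintro _ hl rfl
  obtain ⟨a, ha, rfl⟩ := Finset.mem_image.1 hl
  exact hA ha

theorem avoids_nnotLits {S : Finset (Literal α)} (hS : Avoids q S) : Avoids q (nnotLits S) := by
  intro l hl
  obtain ⟨m, hm, rfl⟩ := Finset.mem_image.1 hl
  rw [atom_negate, atom_negate]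
  exact hS m hm

omit [DecidableEq α] in
theorem avoids_singleton {l : Literal α} (hl : l.atom ≠ q) : Avoids q {l} := by
  simpa [Avoids] using hl

theorem notMem_headWo (r : Rule α) : q ∉ r.headWo q := fun h => (Rule.mem_headWo.1 h).2 rfl

/-- Reducedness is needed because heads from `R₀` and bodies from `R₄` enter derived rules
unstripped. -/
theorem notMem_atoms_of_derived (hP : ∀ r ∈ P, r.IsReduced) {r : Rule α} (hr : Derived q P r) :
    q ∉ r.atoms := by
  suffices h : q ∉ r.head ∧ Avoids q r.body by
    rw [Rule.atoms, Finset.mem_union, Finset.mem_image]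
    rintro (hq | ⟨l, hl, hq⟩)
    exacts [h.1 hq, h.2 l hl hq]
  have hH : ∀ r : Rule α, q ∉ r.headWo q := notMem_headWo
  have hB : ∀ r : Rule α, Avoids q (r.bodyWo q) := avoids_bodyWo
  have hD : ∀ {Q : Program α} {D}, D ∈ asDual q Q → Avoids q D :=
    fun hD l hl => atom_ne_of_mem_asDual hD hl
  have hne : ∀ {r : Rule α} {a : α}, a ∈ r.headWo q → a ≠ q := fun h => (Rule.mem_headWo.1 h).2
  have hNA : ∀ r : Rule α, Avoids q (notAtoms (r.headWo q)) := fun r => avoids_notAtoms (hH r)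
  have hNL : ∀ r : Rule α, Avoids q (nnotLits (r.bodyWo q)) := fun r => avoids_nnotLits (hB r)
  have hNL' : ∀ {r s : Rule α} {a : α}, a ∈ s.headWo q →
      Avoids q (nnotLits (r.bodyWo q ∪ {Literal.pos a})) := fun {r _ _} h =>
    avoids_nnotLits (avoids_union.2 ⟨hB r, avoids_singleton (hne h)⟩)
  cases hr with
  | keep hr =>
    rw [← headWo_of_mem_ruR hr, ← bodyWo_of_mem_ruR hr]
    exact ⟨hH _, hB _⟩
  | d1a h0 h4 =>
    rw [← headWo_of_mem_ruR0 hP h0, ← bodyWo_of_mem_ruR4 hP h4]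
    simp [avoids_union, *]
  | d2a h0 h3 h' =>
    rw [← headWo_of_mem_ruR0 hP h0]
    simp [avoids_union, *]
  | d3a h0 h3 hh hd =>
    rw [← headWo_of_mem_ruR0 hP h0] at *
    simp only [avoids_union]
    exact ⟨hH _, ⟨⟨⟨hB _, avoids_singleton (hne hh)⟩, hD hd⟩, hB _⟩, hNA _⟩
  | d1b h2 h4 =>
    rw [← headWo_of_mem_ruR2 h2, ← bodyWo_of_mem_ruR4 hP h4]
    simp [avoids_union, *]
  | d2b h2 h3 h' =>
    rw [← headWo_of_mem_ruR2 h2]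
    simp only [avoids_union]
    exact ⟨hH _, ⟨hB _, avoids_notAtoms (by simp [hH])⟩,
      avoids_nnotLits (avoids_union.2 ⟨hB _, hB _⟩)⟩
  | d3b h2 h3 hh hd =>
    rw [← headWo_of_mem_ruR2 h2] at *
    simp only [avoids_union]
    exact ⟨hH _, ⟨⟨hB _, hNA _⟩, hNL' hh⟩, hD hd⟩
  | d4 h' hd _ => exact ⟨hH _, avoids_union.2 ⟨hB _, hD hd⟩⟩
  | @d5 r' r3 r D h' h3 hr hd _ =>
    have hw : r.headWo q = r.head := (Finset.mem_union.1 hr).elim (headWo_of_mem_ruR0 hP)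
      headWo_of_mem_ruR2
    rw [← hw]
    simp only [avoids_union]
    exact ⟨hH _, ⟨⟨hB _, avoids_notAtoms (by simp [hH])⟩,
      avoids_nnotLits (avoids_union.2 ⟨hB _, hB _⟩)⟩, hD hd⟩
  | d6 h' h3 hh hd =>
    simp only [avoids_union]
    exact ⟨hH _, ⟨⟨hB _, hNA _⟩, hNL' hh⟩, hD hd⟩
  | d7 h0 h3 h3' _ hd hh =>
    rw [← headWo_of_mem_ruR0 hP h0] at *
    simp only [avoids_union]
    exact ⟨by simp [hH], ⟨⟨⟨hB _, hB _⟩, hNA _⟩, hNL' hh⟩, hD hd⟩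

theorem htSat_fSP_diff_singleton (hXY : X ⊆ Y) :
    (fSP P q).HTSat (X \ {q}) (Y \ {q}) ↔ (fSP P q).HTSat X Y := by
  rw [fSP, htSat_NF hXY, htSat_NF (Set.sdiff_subset_sdiff_left hXY)]
  refine htSat_diff_singleton fun h => ?_
  obtain ⟨r, hr, hq⟩ := Finset.mem_biUnion.1 h
  exact notMem_atoms_of_derived (fun r => isReduced_of_mem_NF)
    ((finite_derived q (NF P)).mem_toFinset.1 hr) hq

/-! ### Failure of `Ω` as comparability. -/

theorem RelInsert.mem_atoms (h : P.RelInsert q Y) : q ∈ P.atoms := by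
  by_contra hq
  refine h.2 ((htSat_congr (fun a ha => ?_) fun _ _ => Iff.rfl).1 h.1)
  have : a ≠ q := fun e => hq (e ▸ ha)
  simp [this]

theorem mem_RYA_empty_iff (hY : q ∉ Y) (hXY : X ⊆ Y) (hYP : Y ⊆ P.atoms) :
    X ∈ RYA P {q} Y ∅ ↔ P.HTSat X Y := by
  simp only [RYA, Set.union_empty, mem_HT_iff, Set.mem_ofPred_eq]
  constructor
  · rintro ⟨Z, ⟨hZ, -, h⟩, rfl⟩
    rwa [Set.sdiff_singleton_eq_self fun hq => hY (hZ hq)]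
  · exact fun h => ⟨X, ⟨hXY, hYP, h⟩, (Set.sdiff_singleton_eq_self fun hq => hY (hXY hq)).symm⟩

theorem mem_RYA_singleton_iff (hY : q ∉ Y) (hXY : X ⊆ Y) (hYP : Y ⊆ P.atoms) (hq : q ∈ P.atoms) :
    X ∈ RYA P {q} Y {q} ↔ P.MemInsert q X Y := by
  have hqX : q ∉ X := fun h => hY (hXY h)
  simp only [RYA, Set.union_singleton, mem_HT_iff, Set.mem_ofPred_eq, MemInsert]
  constructor
  · rintro ⟨Z, ⟨hZ, -, h⟩, rfl⟩
    by_cases hqZ : q ∈ Z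
    · exact .inr (by rwa [Set.insert_sdiff_singleton, Set.insert_eq_of_mem hqZ])
    · exact .inl (by rwa [Set.sdiff_singleton_eq_self hqZ])
  · have : insert q Y ⊆ (P.atoms : Set α) := Set.insert_subset hq hYP
    rintro (h | h)
    · exact ⟨X, ⟨hXY.trans (Set.subset_insert q Y), this, h⟩,
        (Set.sdiff_singleton_eq_self hqX).symm⟩
    · exact ⟨insert q X, ⟨Set.insert_subset_insert hXY, this, h⟩,
        (Set.insert_sdiff_self_of_notMem hqX).symm⟩

/-- Both `∅` and `{q}` are relevant, so a least `R^{Y,A}` exists; whichever `A` attains it, its set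
is included in the other one. -/
theorem comparable_of_not_satisfiesOmega_of_subset (hΩ : ¬ SatisfiesOmega P {q}) (hY : q ∉ Y)
    (hYP : Y ⊆ P.atoms) (hE : P.RelEmpty Y) (hI : P.RelInsert q Y) :
    (∀ X ⊆ Y, P.HTSat X Y → P.MemInsert q X Y) ∨ ∀ X ⊆ Y, P.MemInsert q X Y → P.HTSat X Y := by
  have hq := hI.mem_atoms
  have hqY : insert q Y ⊆ (P.atoms : Set α) := Set.insert_subset hq hYP
  have rE : ∅ ∈ Rel P {q} Y := by
    refine ⟨Set.empty_subset _, ?_, fun ⟨A, hA, _⟩ => hA.2 (Set.empty_subset A)⟩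
    simpa [mem_HT_iff, hYP, RelEmpty] using hE
  have rI : {q} ∈ Rel P {q} Y := by
    refine ⟨subset_rfl, ?_, ?_⟩
    · simpa [mem_HT_iff, hqY] using hI.1
    · rintro ⟨A, hA, h⟩
      rw [Set.ssubset_singleton_iff] at hA
      subst hA
      rw [Set.union_empty, Set.union_singleton, mem_HT_iff] at h
      exact hI.2 h.2.2
  have hex : ∃ S, IsLeast (RY P {q} Y) S := by
    by_contra h
    exact hΩ ⟨Y, fun a ha e => hY (by rwa [← show a = q from e]), ⟨_, ∅, rE, rfl⟩, h⟩
  obtain ⟨_, ⟨A, hA, rfl⟩, hS⟩ := hex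
  rcases Set.subset_singleton_iff_eq.1 hA.1 with rfl | rfl
  · refine .inl fun X hX h => ?_
    rw [← mem_RYA_singleton_iff hY hX hYP hq]
    exact hS ⟨_, rI, rfl⟩ ((mem_RYA_empty_iff hY hX hYP).2 h)
  · refine .inr fun X hX h => ?_
    rw [← mem_RYA_empty_iff hY hX hYP]
    exact hS ⟨_, rE, rfl⟩ ((mem_RYA_singleton_iff hY hX hYP hq).2 h)

theorem htSat_insert_inter_atoms :
    P.HTSat (insert q (X ∩ P.atoms)) (insert q (Y ∩ P.atoms)) ↔
      P.HTSat (insert q X) (insert q Y) :=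
  htSat_congr (by simp +contextual) (by simp +contextual)

theorem htSat_insert_right_inter_atoms :
    P.HTSat (X ∩ P.atoms) (insert q (Y ∩ P.atoms)) ↔ P.HTSat X (insert q Y) :=
  htSat_congr (by simp +contextual) (by simp +contextual)

/-- `Ω` speaks only of `Y` inside the signature of `P`, but `R` may bring in further atoms; these do
not affect satisfaction of `P` and are intersected away. -/
theorem comparable_of_not_satisfiesOmega (hΩ : ¬ SatisfiesOmega P {q}) (hY : q ∉ Y)
    (hE : P.RelEmpty Y) (hI : P.RelInsert q Y) :
    (∀ X ⊆ Y, P.HTSat X Y → P.MemInsert q X Y) ∨ ∀ X ⊆ Y, P.MemInsert q X Y → P.HTSat X Y := by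
  have := comparable_of_not_satisfiesOmega_of_subset hΩ (Y := Y ∩ P.atoms) (fun h => hY h.1)
    Set.inter_subset_right (htSat_inter_atoms.2 hE)
    ⟨htSat_insert_inter_atoms.2 hI.1, fun h => hI.2 (htSat_insert_right_inter_atoms.1 h)⟩
  have key : ∀ X, (P.MemInsert q (X ∩ P.atoms) (Y ∩ P.atoms) ↔ P.MemInsert q X Y) := fun X =>
    or_congr htSat_insert_right_inter_atoms htSat_insert_inter_atoms
  refine this.imp (fun h X hX hs => ?_) fun h X hX hs => ?_
  · exact (key X).1 (h _ (Set.inter_subset_inter_left _ hX) (htSat_inter_atoms.2 hs))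
  · exact htSat_inter_atoms.1 (h _ (Set.inter_subset_inter_left _ hX) ((key X).2 hs))

/-! ### Answer sets after adding a program without `q`. -/

variable {R : Program α}

theorem htSat_insert_right_of_notMem (hR : q ∉ R.atoms) (hX : q ∉ X) (hY : q ∉ Y) :
    R.HTSat X (insert q Y) ↔ R.HTSat X Y := by
  rw [← htSat_diff_singleton hR, Set.insert_sdiff_self_of_notMem hY,
    Set.sdiff_singleton_eq_self hX]

theorem htSat_insert_insert_of_notMem (hR : q ∉ R.atoms) (hX : q ∉ X) (hY : q ∉ Y) :
    R.HTSat (insert q X) (insert q Y) ↔ R.HTSat X Y := by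
  rw [← htSat_diff_singleton hR, Set.insert_sdiff_self_of_notMem hY,
    Set.insert_sdiff_self_of_notMem hX]

/-- The proper subsets of `Y ∪ {q}` are `Y`, excluded by `RelInsert`, and `X` or `X ∪ {q}` for `X ⊂
Y`, the two disjuncts of `MemInsert`. -/
theorem insert_mem_AS_union_iff (hR : q ∉ R.atoms) (hY : q ∉ Y) :
    insert q Y ∈ AS (P ∪ R) ↔ P.RelInsert q Y ∧ R.HTSat Y Y ∧
      ∀ X, X ⊂ Y → R.HTSat X Y → ¬ P.MemInsert q X Y := by
  simp only [mem_AS_iff, htSat_union, htSat_insert_insert_of_notMem hR hY hY]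
  constructor
  · rintro ⟨⟨h1, h2⟩, h3⟩
    refine ⟨⟨h1, fun h => h3 Y (Set.ssubset_insert hY)
      ⟨h, (htSat_insert_right_of_notMem hR hY hY).2 h2⟩⟩, h2, fun X hX hRX h => ?_⟩
    have hqX : q ∉ X := fun h => hY (hX.subset h)
    rcases h with h | h
    · exact h3 X (hX.trans (Set.ssubset_insert hY))
        ⟨h, (htSat_insert_right_of_notMem hR hqX hY).2 hRX⟩
    · refine h3 (insert q X) ⟨Set.insert_subset_insert hX.subset, fun h' => hX.2 fun a ha => ?_⟩
        ⟨h, (htSat_insert_insert_of_notMem hR hqX hY).2 hRX⟩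
      exact (h' (Set.mem_insert_of_mem q ha)).resolve_left fun e => hY (e ▸ ha)
  · rintro ⟨⟨h1, h1'⟩, h2, h3⟩
    refine ⟨⟨h1, h2⟩, fun Z hZ ⟨hPZ, hRZ⟩ => ?_⟩
    have hsub : Z \ {q} ⊆ Y := fun a ha => (hZ.subset ha.1).resolve_left ha.2
    have hq : q ∉ Z \ {q} := fun h => h.2 rfl
    have hRZ' : R.HTSat (Z \ {q}) Y := by
      rwa [← htSat_diff_singleton hR, Set.insert_sdiff_self_of_notMem hY] at hRZ
    by_cases hqZ : q ∈ Z
    · have hins : insert q (Z \ {q}) = Z := by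
        rw [Set.insert_sdiff_singleton, Set.insert_eq_of_mem hqZ]
      refine h3 (Z \ {q}) ⟨hsub, fun h => hZ.2 ?_⟩ hRZ' (.inr (by rwa [hins]))
      exact Set.insert_subset hqZ (h.trans Set.sdiff_subset)
    · rw [Set.sdiff_singleton_eq_self hqZ] at *
      by_cases e : Z = Y
      · exact h1' (e ▸ hPZ)
      · exact h3 Z (hsub.ssubset_of_ne e) hRZ' (.inl hPZ)

theorem mem_exclusion_AS_iff :
    Y ∈ exclusion (AS P) {q} ↔ q ∉ Y ∧ (Y ∈ AS P ∨ insert q Y ∈ AS P) := by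
  constructor
  · rintro ⟨Z, hZ, rfl⟩
    refine ⟨fun h => h.2 rfl, ?_⟩
    by_cases hq : q ∈ Z
    · exact .inr (by rwa [Set.insert_sdiff_singleton, Set.insert_eq_of_mem hq])
    · exact .inl (by rwa [Set.sdiff_singleton_eq_self hq])
  · rintro ⟨hq, h | h⟩
    · exact ⟨Y, h, (Set.sdiff_singleton_eq_self hq).symm⟩
    · exact ⟨_, h, (Set.insert_sdiff_self_of_notMem hq).symm⟩

/-- Neither program can see `q`, so removing it from `Y` would give a smaller model. -/
theorem notMem_of_mem_AS_fSP_union (hR : q ∉ R.atoms) (h : Y ∈ AS (fSP P q ∪ R)) : q ∉ Y := by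
  intro hq
  rw [mem_AS_iff] at h
  refine h.2 (Y \ {q}) ⟨Set.sdiff_subset, fun h' => (h' hq).2 rfl⟩ ?_
  rw [htSat_union] at h ⊢
  have e : (Y \ {q}) \ {q} = Y \ {q} := Set.sdiff_singleton_eq_self fun h => h.2 rfl
  rw [← htSat_fSP_diff_singleton Set.sdiff_subset, ← htSat_diff_singleton hR, e,
    htSat_fSP_diff_singleton subset_rfl, htSat_diff_singleton hR]
  exact h.1

theorem mem_AS_fSP_union_iff (hΩ : ¬ SatisfiesOmega P {q}) (hR : q ∉ R.atoms) (hY : q ∉ Y) :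
    Y ∈ AS (fSP P q ∪ R) ↔ Y ∈ AS (P ∪ R) ∨ insert q Y ∈ AS (P ∪ R) := by
  have hf : ∀ X ⊆ Y, ((fSP P q).HTSat X Y ↔ P.Remains q X Y) := fun X hX => htSat_fSP_iff hY hX
  rw [insert_mem_AS_union_iff hR hY]
  simp only [mem_AS_iff, htSat_union, hf Y subset_rfl]
  constructor
  · rintro ⟨⟨h1, h2⟩, h3⟩
    have h3' : ∀ X, X ⊂ Y → R.HTSat X Y → ¬ P.Remains q X Y := fun X hX hRX h =>
      h3 X hX ⟨(hf X hX.subset).2 h, hRX⟩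
    by_cases hE : P.RelEmpty Y
    · by_cases hI : P.RelInsert q Y
      -- The only use of `Ω`: a counterexample to minimality for the smaller of the two sets lies in
      -- both, hence in `Remains`.
      · refine (comparable_of_not_satisfiesOmega hΩ hY hE hI).imp (fun hc => ?_) fun hc => ?_
        · exact ⟨⟨hE, h2⟩, fun X hX h =>
            h3' X hX h.2 ⟨h1.total, fun _ => h.1, fun _ => hc X hX.subset h.1⟩⟩
        · exact ⟨hI, h2, fun X hX hRX h =>
            h3' X hX hRX ⟨h1.total, fun _ => hc X hX.subset h, fun _ => h⟩⟩
      · exact .inl ⟨⟨hE, h2⟩, fun X hX h =>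
          h3' X hX h.2 ⟨h1.total, fun _ => h.1, fun h' => absurd h' hI⟩⟩
    · exact .inr ⟨h1.total.resolve_left hE, h2, fun X hX hRX h =>
        h3' X hX hRX ⟨h1.total, fun h' => absurd h' hE, fun _ => h⟩⟩
  · rintro (⟨⟨h1, h2⟩, h3⟩ | ⟨h1, h2, h3⟩)
    · exact ⟨⟨⟨.inl h1, fun _ => h1, MemInsert.self⟩, h2⟩, fun X hX h =>
        h3 X hX ⟨((hf X hX.subset).1 h.1).without h1, h.2⟩⟩
    · exact ⟨⟨⟨.inr h1, id, MemInsert.self⟩, h2⟩, fun X hX h =>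
        h3 X hX h.2 (((hf X hX.subset).1 h.1).insert h1)⟩

end Program

end ASP

theorem mainTheorem2 {α : Type*} [DecidableEq α] (P : ASP.Program α) (q : α)
    (hΩ : ¬ ASP.Program.SatisfiesOmega P {q}) :
    ASP.Program.StronglyPersistent ASP.Program.fSP P q := by
  intro R hR
  ext Y
  rw [ASP.Program.mem_exclusion_AS_iff]
  constructor
  · intro h
    have hY := ASP.Program.notMem_of_mem_AS_fSP_union hR h
    exact ⟨hY, (ASP.Program.mem_AS_fSP_union_iff hΩ hR hY).1 h⟩
  · exact fun h => (ASP.Program.mem_AS_fSP_union_iff hΩ hR h.1).2 h.2
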